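/- Let $0<\lambda<1$, $b>0$, $A>0$, and let $g:\mathbb N_0\to[0,\infty)$ satisfy $g(n)=0\Leftrightarrow n=0$. Assume that the weights $w(n)=\prod_{k=1}^n 1/g(k)$ satisfy $$w(n)\simeq A\exp\Big(-\tfrac{b}{1-\lambda}\,n^{1-\lambda}\Big)\qquad(n\to\infty),$$ where $a_n\simeq b_n$ means $a_n/b_n\to1$. Let $\nu$ be the law under which the occupation numbers $\eta_1,\dots,\eta_L$ are i.i.d. with $\nu[\eta_i=n]=w(n)/\sum_{m\ge0}w(m)$ (the stationary product measure of the zero-range process with rates $g$ at the critical fugacity $\phi_c=1$), and let $\rho_c=\mathbb E^\nu[\eta_i]$ be the critical density. Let $M_L=\max_{i\le L}\eta_i$, $S_L=\sum_{i\le L}\eta_i$ and $\mu_{L,N}=\nu[\,\cdot\mid S_L=N]$. For a sequence $N=N_L\in\mathbb N_0$ with $N/L\to\rho_c$ and $N\le\rho_cL$ for all large $L$, define $\omega_L\ge0$ for large $L$ by $$N=\rho_cL-\omega_L\,L\,(\log L)^{-\frac1{1-\lambda}} .$$ 1. If $\omega_L\to c\in[0,+\infty]$, then there are sequences $\gamma_L\to\infty$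 and $\zeta_L\to\infty$, which can be chosen strictly increasing if $c<\infty$, such that for all $x\in\mathbb R$ $$\lim_{L\to\infty}\mu_{L,N}\big[M_L\le\gamma_L+x\,\zeta_L\big]=e^{-e^{-x}} .$$ 2. There are sequences $y_L,b_L$, not depending on $N$, with $$y_L\simeq\Big(\tfrac{1-\lambda}{b}\log L\Big)^{\frac1{1-\lambda}},\qquad b_L\simeq\frac{y_L^\lambda}{b},\qquad \lim_{L\to\infty}\nu\big[M_L\le y_L+x\,b_L\big]=e^{-e^{-x}}\quad\text{for all }x\in\mathbb R .$$ For any such sequences, if $\omega_L\to0$, then one can take $\gamma_L=y_L$ and $\zeta_L=b_L$, i.e. $$\lim_{L\to\infty}\mu_{L,N}\big[M_L\le y_L+x\,b_L\big]=e^{-e^{-x}}\qquad\text{for all }x\in\mathbb R .$$ -/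

import Mathlib

open Filter MeasureTheory Topology Asymptotics
open scoped ENNReal

namespace ZeroRange

noncomputable section

/-- Stationary weights `w(n) = ∏_{k=1}^n 1 / g(k)` of the zero-range process with jump rates `g`. -/
def weight (g : ℕ → ℝ) (n : ℕ) : ℝ := ∏ k ∈ Finset.Icc 1 n, 1 / g k

/-- Partition function `z(φ) = ∑_n w(n) φ^n`. -/
def partitionFn (g : ℕ → ℝ) (φ : ℝ) : ℝ := ∑' n : ℕ, weight g n * φ ^ n

/-- One-site marginal of the product measure with fugacity `φ`: mass `w(n) φ^n / z(φ)` at `n`. -/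
def siteMeasure (g : ℕ → ℝ) (φ : ℝ) : Measure ℕ :=
  Measure.sum fun n : ℕ =>
    ENNReal.ofReal (weight g n * φ ^ n / partitionFn g φ) • Measure.dirac n

/-- The product measure `ν_φ` on the configurations on `L` sites. -/
def grandCanonical (g : ℕ → ℝ) (φ : ℝ) (L : ℕ) : Measure (Fin L → ℕ) :=
  Measure.pi fun _ => siteMeasure g φ

/-- The particle density `R(φ) = E^{ν_φ}[η_x]`. -/
def density (g : ℕ → ℝ) (φ : ℝ) : ℝ := ∫ n, (n : ℝ) ∂(siteMeasure g φ)

/-- The critical density `ρ_c = R(1)`; the critical fugacity is `φ_c = 1`. -/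
def criticalDensity (g : ℕ → ℝ) : ℝ := density g 1

/-- Total number of particles `S_L`. -/
def total {L : ℕ} (η : Fin L → ℕ) : ℕ := ∑ i, η i

/-- Maximal occupation number `M_L`. -/
def maxOcc {L : ℕ} (η : Fin L → ℕ) : ℕ := Finset.univ.sup η

/-- The canonical measure `μ_{L,N} = ν_φ[ · | S_L = N]`. It does not depend on the fugacity, which
is taken to be the critical one. -/
def canonical (g : ℕ → ℝ) (L N : ℕ) : Measure (Fin L → ℕ) :=
  ProbabilityTheory.cond (grandCanonical g 1 L) {η | total η = N}

/-- `P_L[M_L ≤ u_L + x v_L] → exp(-exp(-x))` for every real `x`. -/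
def MaxGumbelLimit (P : (L : ℕ) → Measure (Fin L → ℕ)) (u v : ℕ → ℝ) : Prop :=
  ∀ x : ℝ, Tendsto (fun L : ℕ => (P L).real {η | (maxOcc η : ℝ) ≤ u L + x * v L}) atTop
    (𝓝 (Real.exp (-Real.exp (-x))))

/-- Rates `g` with `g(n) = 0 ↔ n = 0` whose stationary weights satisfy
`w(n) ≃ A exp(-b/(1-λ) n^{1-λ})`, where `0 < λ < 1` and `b, A > 0`. -/
structure IsStretchedExp (g : ℕ → ℝ) (lam b A : ℝ) : Prop where
  lam_pos : 0 < lam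
  lam_lt_one : lam < 1
  b_pos : 0 < b
  A_pos : 0 < A
  rate_nonneg : ∀ n, 0 ≤ g n
  rate_eq_zero_iff : ∀ n, g n = 0 ↔ n = 0
  weight_equiv : (fun n : ℕ => weight g n) ~[atTop]
    fun n : ℕ => A * Real.exp (-(b / (1 - lam)) * (n : ℝ) ^ (1 - lam))

/-- `y, bL` are scales of the maximum of the unconditioned system at criticality:
`y_L ≃ ((1-λ)/b log L)^{1/(1-λ)}`, `b_L ≃ y_L^λ / b` and
`ν_{φ_c}[(M_L - y_L)/b_L ≤ x] → exp(-exp(-x))`. -/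
structure IsCriticalGumbelScale (g : ℕ → ℝ) (lam b : ℝ) (y bL : ℕ → ℝ) : Prop where
  y_equiv : y ~[atTop] fun L : ℕ => ((1 - lam) / b * Real.log (L : ℝ)) ^ (1 / (1 - lam))
  b_equiv : bL ~[atTop] fun L : ℕ => y L ^ lam / b
  gumbel : MaxGumbelLimit (grandCanonical g 1) y bL

/-- Thermodynamic limit `N/L → ρ_c` from below, with
`N = ρ_c L - ω_L L (log L)^{-1/(1-λ)}` and `ω_L ≥ 0` (for all large `L`). -/
structure IsDownside (g : ℕ → ℝ) (lam : ℝ) (N : ℕ → ℕ) (ω : ℕ → ℝ) : Prop where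
  nonneg : ∀ᶠ L : ℕ in atTop, 0 ≤ ω L
  eq : ∀ᶠ L : ℕ in atTop, (N L : ℝ) =
    criticalDensity g * L - ω L * L * Real.log (L : ℝ) ^ (-(1 / (1 - lam)))
  critical : Tendsto (fun L : ℕ => (N L : ℝ) / L) atTop (𝓝 (criticalDensity g))

end

end ZeroRange

namespace ZeroRange

/-! Conditioning on `S_L = N` does not see an exponential tilt of the site law by `e^{-s n}`
(`totalMass_tilt`). Since `N ≤ ρ_c L`, there is `s_L ≥ 0` for which the tilted law has mean exactly
`N/L`; moreover `s_L → 0`, with `s_L ≃ (ρ_c - N/L)/σ²` when the deficit is nonzero (`exists_tilt`).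

The event `M_L ≤ u_L` restricts every site to `{n ≤ u_L}`. Its conditional probability is a ratio of
two masses of `{S_L = N}`, under the restricted and the full tilted weights. A local limit theorem
for sub-probability weights (`tendsto_sqrt_mul_totalMass`) shows that each mass, times `√L`, tends
to the same Gaussian constant times `e^{-τ}`, where `τ` is the limit of `L` times the missing mass.
The ratio thus tends to `e^{-τ}`, as for i.i.d. variables with the tilted law
(`tendsto_cond_forall_mem`).

What remains is one-site analysis: the tilted tail beyond `t` is `A exp(-ψ_s(t))/ψ_s'(t)`, up to a
factor tending to 1 as `s → 0` and `t → ∞` (`tendsto_tailSum_floor_div`). If `γ_L` is the point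
where this equals `z(1)/L` and `ζ_L = 1/ψ_s'(γ_L)`, then the tail beyond `γ_L + x ζ_L` is `e^{-x}`
times as large, which is the Gumbel law.

If `ω_L → c < ∞`, then `s_L y_L` tends to some `κ` at the critical scale `y_L`, so tilting only
multiplies the relevant tails by `e^{-κ}` (`exists_canonical_shift`). A critical scale with level
raised by `e^κ` compensates this and is strictly increasing. If `c = 0`, then `κ = 0` and the
critical scales serve unchanged. -/

/-- The exponent `ψ_s(t) = b/(1-λ) t^{1-λ} + s t` of the tilted stretched exponential. -/
noncomputable def tiltExponent (lam b s t : ℝ) : ℝ := b / (1 - lam) * t ^ (1 - lam) + s * t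

/-- The derivative `ψ_s'(t) = b t^{-λ} + s` of the exponent. -/
noncomputable def tiltSlope (lam b s t : ℝ) : ℝ := b * t ^ (-lam) + s

/-- The asymptotic tail profile `exp(-ψ_s(t)) / ψ_s'(t)`. -/
noncomputable def tailProfile (lam b s t : ℝ) : ℝ :=
  Real.exp (-tiltExponent lam b s t) / tiltSlope lam b s t

/-! ### Calculus of the tail profile, uniformly in the tilt. -/

section Profile

variable {lam b s t : ℝ}

lemma tiltSlope_pos (hb : 0 < b) (hs : 0 ≤ s) (ht : 0 < t) : 0 < tiltSlope lam b s t := by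
  unfold tiltSlope; positivity

lemma tailProfile_pos (hb : 0 < b) (hs : 0 ≤ s) (ht : 0 < t) : 0 < tailProfile lam b s t :=
  div_pos (Real.exp_pos _) (tiltSlope_pos hb hs ht)

lemma hasDerivAt_tiltExponent (hl : lam < 1) (ht : 0 < t) :
    HasDerivAt (tiltExponent lam b s) (tiltSlope lam b s t) t := by
  have h := (Real.hasDerivAt_rpow_const (p := 1 - lam) (Or.inl ht.ne')).const_mul (b / (1 - lam))
  have h2 := h.add ((hasDerivAt_id t).const_mul s)
  refine (h2.congr_deriv ?_).congr_of_eventuallyEq (Eventually.of_forall fun x => by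
    simp [tiltExponent])
  have : 1 - lam ≠ 0 := by linarith
  rw [show 1 - lam - 1 = -lam by ring]
  simp only [tiltSlope]
  field_simp

lemma hasDerivAt_tiltSlope (ht : 0 < t) :
    HasDerivAt (tiltSlope lam b s) (-(lam * b * t ^ (-lam - 1))) t := by
  have h := ((Real.hasDerivAt_rpow_const (p := -lam) (Or.inl ht.ne')).const_mul b).add_const s
  exact h.congr_deriv (by ring)

/-- The profile is the leading Laplace term of `∫_t^∞ e^{-ψ_s}`: its derivative is `-e^{-ψ_s}` up to
the relative correction `-ψ_s''/ψ_s'^2`. -/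
lemma hasDerivAt_tailProfile (hl : lam < 1) (hb : 0 < b) (hs : 0 ≤ s) (ht : 0 < t) :
    HasDerivAt (tailProfile lam b s)
      (-(Real.exp (-tiltExponent lam b s t) *
        (1 - lam * b * t ^ (-lam - 1) / tiltSlope lam b s t ^ 2))) t := by
  have hp := (tiltSlope_pos (lam := lam) hb hs ht).ne'
  have h := ((hasDerivAt_tiltExponent (b := b) (s := s) hl ht).neg.exp).div
    (hasDerivAt_tiltSlope (b := b) (lam := lam) (s := s) ht) hp
  refine h.congr_deriv ?_
  simp only [Pi.neg_apply]
  field_simp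
  ring

/-- As `ψ_s' ≥ b t^{-λ}`, the correction is largest at `s = 0`, where it is `(λ/b) t^{λ-1}`. This
bound is free of `s` and vanishes as `t → ∞`. -/
lemma slope_curvature_le (hl0 : 0 < lam) (hb : 0 < b) (hs : 0 ≤ s) (ht : 0 < t) :
    lam * b * t ^ (-lam - 1) / tiltSlope lam b s t ^ 2 ≤ lam / b * t ^ (lam - 1) := by
  have h1 : 0 < t ^ (-lam) := Real.rpow_pos_of_pos ht _
  rw [div_le_iff₀ (pow_pos (tiltSlope_pos hb hs ht) 2)]
  have h2 : (b * t ^ (-lam)) ^ 2 ≤ tiltSlope lam b s t ^ 2 := by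
    apply pow_le_pow_left₀ (by positivity)
    unfold tiltSlope; linarith
  have h3 : lam * b * t ^ (-lam - 1) = lam / b * t ^ (lam - 1) * (b * t ^ (-lam)) ^ 2 := by
    have : t ^ (lam - 1) * (t ^ (-lam)) ^ 2 = t ^ (-lam - 1) := by
      rw [← Real.rpow_natCast, ← Real.rpow_mul ht.le, ← Real.rpow_add ht]
      congr 1; push_cast; ring
    rw [← this]; field_simp
  rw [h3]
  exact mul_le_mul_of_nonneg_left h2 (by positivity)

lemma tiltSlope_antitone (hl0 : 0 < lam) (hb : 0 < b) {x y : ℝ} (hx : 0 < x) (hxy : x ≤ y) :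
    tiltSlope lam b s y ≤ tiltSlope lam b s x := by
  unfold tiltSlope
  have := Real.rpow_le_rpow_of_nonpos hx hxy (by linarith : -lam ≤ 0)
  nlinarith

lemma tiltExponent_mono (hl : lam < 1) (hb : 0 < b) (hs : 0 ≤ s) {x y : ℝ} (hx : 0 ≤ x)
    (hxy : x ≤ y) : tiltExponent lam b s x ≤ tiltExponent lam b s y := by
  unfold tiltExponent
  have h1 := Real.rpow_le_rpow hx hxy (by linarith : 0 ≤ 1 - lam)
  have h2 : 0 ≤ b / (1 - lam) := div_nonneg hb.le (by linarith)
  gcongr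

/-- One step of the tail profile is comparable with the weight at the right end point. -/
lemma tailProfile_step (hl0 : 0 < lam) (hl : lam < 1) (hb : 0 < b) (hs : 0 ≤ s) (ht : 0 < t)
    (htl : lam / b * t ^ (lam - 1) ≤ 1) :
    Real.exp (-tiltExponent lam b s (t + 1)) * (1 - lam / b * t ^ (lam - 1)) ≤
        tailProfile lam b s t - tailProfile lam b s (t + 1) ∧
      tailProfile lam b s t - tailProfile lam b s (t + 1) ≤
        Real.exp (-tiltExponent lam b s (t + 1)) * Real.exp (tiltSlope lam b s t) := by
  obtain ⟨ξ, hξ, hd⟩ := exists_hasDerivAt_eq_slope (tailProfile lam b s) _ (by linarith : t < t + 1)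
    (fun x hx => (hasDerivAt_tailProfile hl hb hs
      (ht.trans_le hx.1)).continuousAt.continuousWithinAt)
    (fun x hx => hasDerivAt_tailProfile hl hb hs (ht.trans hx.1))
  have hξ0 : 0 < ξ := ht.trans hξ.1
  have hd' : tailProfile lam b s t - tailProfile lam b s (t + 1) =
      Real.exp (-tiltExponent lam b s ξ) *
        (1 - lam * b * ξ ^ (-lam - 1) / tiltSlope lam b s ξ ^ 2) := by
    rw [show t + 1 - t = 1 by ring, div_one] at hd; linarith
  have hcurv := slope_curvature_le hl0 hb hs hξ0
  have hcurv0 : 0 ≤ lam * b * ξ ^ (-lam - 1) / tiltSlope lam b s ξ ^ 2 := by positivity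
  have hmono : lam / b * ξ ^ (lam - 1) ≤ lam / b * t ^ (lam - 1) := by
    have := Real.rpow_le_rpow_of_nonpos ht hξ.1.le (by linarith : lam - 1 ≤ 0)
    gcongr
  have hE1 : Real.exp (-tiltExponent lam b s (t + 1)) ≤ Real.exp (-tiltExponent lam b s ξ) := by
    apply Real.exp_le_exp.2
    linarith [tiltExponent_mono hl hb hs hξ0.le hξ.2.le]
  have hE2 : Real.exp (-tiltExponent lam b s ξ) ≤
      Real.exp (-tiltExponent lam b s (t + 1)) * Real.exp (tiltSlope lam b s t) := by
    rw [← Real.exp_add]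
    apply Real.exp_le_exp.2
    -- Over the unit step `ψ_s` grows by its slope at an interior point, at most the slope at the
    -- left end.
    obtain ⟨y, hy, hyd⟩ := exists_hasDerivAt_eq_slope (tiltExponent lam b s) _
      (by linarith : t < t + 1)
      (fun x hx => (hasDerivAt_tiltExponent hl (ht.trans_le hx.1)).continuousAt.continuousWithinAt)
      (fun x hx => hasDerivAt_tiltExponent hl (ht.trans hx.1))
    have := tiltSlope_antitone (lam := lam) (s := s) hl0 hb ht hy.1.le
    rw [show t + 1 - t = 1 by ring, div_one] at hyd
    linarith [tiltExponent_mono hl hb hs ht.le hξ.1.le]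
  rw [hd']
  constructor
  · exact mul_le_mul hE1 (by linarith) (by linarith) (Real.exp_pos _).le
  · exact (mul_le_of_le_one_right (Real.exp_pos _).le (by linarith)).trans hE2

end Profile

/-! ### Asymptotics of tilted tail sums. -/

section Tail

variable {lam b s t : ℝ}

/-- Dropping `s` from numerator and denominator bounds the profile by `(1/b) t^λ exp(-(b/(1-λ))
t^{1-λ})`, a power times a decaying exponential in the variable `t^{1-λ}`. -/
lemma tendsto_tailProfile_atTop (hl : lam < 1) (hb : 0 < b) (hs : 0 ≤ s) :
    Tendsto (tailProfile lam b s) atTop (𝓝 0) := by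
  have h1 : Tendsto (fun t : ℝ => t ^ (1 - lam)) atTop atTop :=
    tendsto_rpow_atTop (by linarith)
  have hc : 0 < b / (1 - lam) := div_pos hb (by linarith)
  have h2 : Tendsto (fun t : ℝ => 1 / b * ((t ^ (1 - lam)) ^ (lam / (1 - lam)) *
      Real.exp (-(b / (1 - lam)) * t ^ (1 - lam)))) atTop (𝓝 0) := by
    have := ((tendsto_rpow_mul_exp_neg_mul_atTop_nhds_zero (lam / (1 - lam)) _ hc).comp h1).const_mul
      (1 / b)
    simpa using this
  refine squeeze_zero' ?_ ?_ h2
  · filter_upwards [eventually_gt_atTop 0] with t ht using (tailProfile_pos hb hs ht).le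
  · filter_upwards [eventually_gt_atTop 0] with t ht
    have hp : (t ^ (1 - lam)) ^ (lam / (1 - lam)) = t ^ lam := by
      rw [← Real.rpow_mul ht.le]; congr 1
      have : 1 - lam ≠ 0 := by linarith
      field_simp
    rw [hp]
    have e1 : 1 / b * (t ^ lam * Real.exp (-(b / (1 - lam)) * t ^ (1 - lam))) =
        Real.exp (-(b / (1 - lam)) * t ^ (1 - lam)) / (b * t ^ (-lam)) := by
      rw [Real.rpow_neg ht.le]
      have := (Real.rpow_pos_of_pos ht lam).ne'
      field_simp
    rw [e1]
    unfold tailProfile tiltSlope tiltExponent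
    have : 0 < t ^ (-lam) := Real.rpow_pos_of_pos ht _
    have hst : 0 ≤ s * t := by positivity
    apply div_le_div₀ (Real.exp_pos _).le _ (by positivity) (by linarith)
    apply Real.exp_le_exp.2
    linarith

/-- The tilted tail sum `∑_{n > j} w(n) e^{-s n}`. -/
noncomputable def tailSum (w : ℕ → ℝ) (s : ℝ) (j : ℕ) : ℝ :=
  ∑' k : ℕ, w (j + k + 1) * Real.exp (-s * (j + k + 1 : ℕ))

lemma hasSum_tailProfile_telescope (hl : lam < 1) (hb : 0 < b) (hs : 0 ≤ s)
    {j : ℕ}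
    (hm : ∀ k : ℕ, tailProfile lam b s (j + k + 1 : ℕ) ≤ tailProfile lam b s (j + k : ℕ)) :
    HasSum (fun k : ℕ => tailProfile lam b s (j + k : ℕ) - tailProfile lam b s (j + k + 1 : ℕ))
      (tailProfile lam b s j) := by
  rw [hasSum_iff_tendsto_nat_of_nonneg (fun k => sub_nonneg.2 (hm k))]
  have h1 : ∀ n : ℕ, ∑ k ∈ Finset.range n,
      (tailProfile lam b s (j + k : ℕ) - tailProfile lam b s (j + k + 1 : ℕ)) =
      tailProfile lam b s j - tailProfile lam b s (j + n : ℕ) := fun n => by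
    exact (Finset.sum_range_sub' (fun k : ℕ => tailProfile lam b s (j + k : ℕ)) n).trans (by simp)
  simp_rw [h1]
  have h2 : Tendsto (fun n : ℕ => tailProfile lam b s (j + n : ℕ)) atTop (𝓝 0) :=
    (tendsto_tailProfile_atTop hl hb hs).comp (tendsto_natCast_atTop_atTop.comp
      (tendsto_atTop_mono (fun n => Nat.le_add_left n j) tendsto_id))
  simpa using h2.const_sub (tailProfile lam b s j)

/-- Each summand at `n` is compared with the drop of the profile from `n - 1` to `n`, and the drops
telescope. The thresholds `j₀`, `s₀` do not depend on `s` and `j`, so the tilt may later vary with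
the system size. -/
lemma tailSum_bounds {w : ℕ → ℝ} {A : ℝ} (hl0 : 0 < lam) (hl : lam < 1) (hb : 0 < b) (hA : 0 < A)
    (hw : (fun n : ℕ => w n) ~[atTop]
      fun n : ℕ => A * Real.exp (-(b / (1 - lam)) * (n : ℝ) ^ (1 - lam)))
    {ε : ℝ} (hε : 0 < ε) (hε1 : ε ≤ 1) :
    ∃ j₀ : ℕ, ∃ s₀ > 0, ∀ j ≥ j₀, ∀ s, 0 ≤ s → s ≤ s₀ →
      (1 - ε) * (A * tailProfile lam b s j) ≤ tailSum w s j ∧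
        tailSum w s j ≤ (1 + ε) * (A * tailProfile lam b s j) := by
  -- Two relative errors `η` accumulate, one from the weights and one from the profile; `ε / 4`
  -- gives `(1-ε)(1+η) ≤ 1-η` and `1+η ≤ (1+ε)(1-η)`.
  set η := ε / 4 with hη
  have hη0 : 0 < η := by positivity
  have e1 : ∀ᶠ n : ℕ in atTop,
      ‖w n - A * Real.exp (-(b / (1 - lam)) * (n : ℝ) ^ (1 - lam))‖ ≤
        η * ‖A * Real.exp (-(b / (1 - lam)) * (n : ℝ) ^ (1 - lam))‖ := hw.isLittleO.def hη0
  have e2 : ∀ᶠ n : ℕ in atTop, lam / b * (n : ℝ) ^ (lam - 1) < η := by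
    have : Tendsto (fun n : ℕ => lam / b * (n : ℝ) ^ (lam - 1)) atTop (𝓝 (lam / b * 0)) := by
      have := (tendsto_rpow_neg_atTop (by linarith : 0 < 1 - lam)).comp tendsto_natCast_atTop_atTop
      refine Tendsto.const_mul _ (this.congr fun n => ?_)
      simp
    rw [mul_zero] at this
    exact this.eventually_lt_const hη0
  have hln : 0 < Real.log (1 + η) := Real.log_pos (by linarith)
  -- Half of `log (1 + η)` is reserved for `b n^{-λ}`, the other half for `s`; together they give
  -- `e^{ψ_s'(n)} ≤ 1 + η`.
  have e3 : ∀ᶠ n : ℕ in atTop, b * (n : ℝ) ^ (-lam) < Real.log (1 + η) / 2 := by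
    have : Tendsto (fun n : ℕ => b * (n : ℝ) ^ (-lam)) atTop (𝓝 (b * 0)) :=
      ((tendsto_rpow_neg_atTop hl0).comp tendsto_natCast_atTop_atTop).const_mul _
    rw [mul_zero] at this
    exact this.eventually_lt_const (by positivity)
  obtain ⟨j₀, hj₀⟩ := eventually_atTop.1 ((e1.and (e2.and e3)).and (eventually_gt_atTop 0))
  refine ⟨j₀, Real.log (1 + η) / 2, by positivity, fun j hj s hs hs0 => ?_⟩
  have hjp : 0 < j := (hj₀ j hj).2
  -- comparison of single terms
  have key : ∀ n ≥ j₀, (1 - η) * Real.exp (-tiltExponent lam b s (n + 1 : ℕ)) ≤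
        tailProfile lam b s n - tailProfile lam b s (n + 1 : ℕ) ∧
      tailProfile lam b s n - tailProfile lam b s (n + 1 : ℕ) ≤
        (1 + η) * Real.exp (-tiltExponent lam b s (n + 1 : ℕ)) := by
    intro n hn
    obtain ⟨⟨-, h2, h3⟩, h4⟩ := hj₀ n hn
    have hn0 : (0 : ℝ) < n := by exact_mod_cast h4
    obtain ⟨ha, hc⟩ := tailProfile_step (s := s) hl0 hl hb hs hn0 (by linarith)
    rw [Nat.cast_add_one]
    constructor
    · refine le_trans ?_ ha
      rw [mul_comm]
      gcongr
    · refine hc.trans ?_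
      rw [mul_comm]
      gcongr
      rw [← Real.exp_log (by linarith : 0 < 1 + η)]
      apply Real.exp_le_exp.2
      unfold tiltSlope; linarith
  have keyw : ∀ n ≥ j₀, (1 - η) * (A * Real.exp (-tiltExponent lam b s (n : ℕ))) ≤
        w n * Real.exp (-s * n) ∧
      w n * Real.exp (-s * n) ≤ (1 + η) * (A * Real.exp (-tiltExponent lam b s (n : ℕ))) := by
    intro n hn
    have h1 := (hj₀ n hn).1.1
    have hE : Real.exp (-tiltExponent lam b s (n : ℕ)) =
        Real.exp (-(b / (1 - lam)) * (n : ℝ) ^ (1 - lam)) * Real.exp (-s * n) := by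
      rw [← Real.exp_add]; congr 1; unfold tiltExponent; ring
    rw [hE]
    set B := A * Real.exp (-(b / (1 - lam)) * (n : ℝ) ^ (1 - lam)) with hB
    have hB0 : 0 < B := by positivity
    rw [Real.norm_eq_abs, Real.norm_eq_abs, abs_of_pos hB0, abs_le] at h1
    have hs' := Real.exp_pos (-s * n)
    rw [← mul_assoc A, ← hB, ← mul_assoc (1 - η), ← mul_assoc (1 + η)]
    constructor
    · apply mul_le_mul_of_nonneg_right _ hs'.le; linarith
    · apply mul_le_mul_of_nonneg_right _ hs'.le; linarith
  have htel := hasSum_tailProfile_telescope (s := s) hl hb hs (fun k => by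
    have := (key (j + k) (by omega)).1
    have h2 : 0 ≤ (1 - η) * Real.exp (-tiltExponent lam b s (j + k + 1 : ℕ)) :=
      mul_nonneg (by linarith) (Real.exp_pos _).le
    linarith)
  set D : ℕ → ℝ := fun k =>
    tailProfile lam b s (j + k : ℕ) - tailProfile lam b s (j + k + 1 : ℕ) with hD
  have lo : ∀ k, (1 - ε) * A * D k ≤ w (j + k + 1) * Real.exp (-s * (j + k + 1 : ℕ)) := by
    intro k
    have h1 := (key (j + k) (by omega))
    have h2 := (keyw (j + k + 1) (by omega)).1
    set E := Real.exp (-tiltExponent lam b s (j + k + 1 : ℕ))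
    have hE : 0 < E := Real.exp_pos _
    have h3 : (1 - ε) * (1 + η) ≤ 1 - η := by rw [hη]; nlinarith
    calc (1 - ε) * A * D k ≤ (1 - ε) * A * ((1 + η) * E) :=
          mul_le_mul_of_nonneg_left h1.2 (mul_nonneg (by linarith) hA.le)
      _ = ((1 - ε) * (1 + η)) * (A * E) := by ring
      _ ≤ (1 - η) * (A * E) := by gcongr
      _ ≤ _ := h2
  have hi : ∀ k, w (j + k + 1) * Real.exp (-s * (j + k + 1 : ℕ)) ≤ (1 + ε) * A * D k := by
    intro k
    have h1 := (key (j + k) (by omega))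
    have h2 := (keyw (j + k + 1) (by omega)).2
    set E := Real.exp (-tiltExponent lam b s (j + k + 1 : ℕ))
    have hE : 0 < E := Real.exp_pos _
    have h3 : 1 + η ≤ (1 + ε) * (1 - η) := by rw [hη]; nlinarith
    calc _ ≤ (1 + η) * (A * E) := h2
      _ ≤ ((1 + ε) * (1 - η)) * (A * E) := by gcongr
      _ = (1 + ε) * A * ((1 - η) * E) := by ring
      _ ≤ (1 + ε) * A * D k := by
          exact mul_le_mul_of_nonneg_left h1.1 (by positivity)
  have hDnn : ∀ k, 0 ≤ D k := fun k => by
    have := (key (j + k) (by omega)).1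
    have h2 : 0 ≤ (1 - η) * Real.exp (-tiltExponent lam b s (j + k + 1 : ℕ)) :=
      mul_nonneg (by linarith) (Real.exp_pos _).le
    exact h2.trans this
  have hsum : Summable fun k : ℕ => w (j + k + 1) * Real.exp (-s * (j + k + 1 : ℕ)) := by
    refine Summable.of_nonneg_of_le (fun k => le_trans ?_ (lo k)) hi
      (htel.summable.mul_left _)
    exact mul_nonneg (mul_nonneg (by linarith) hA.le) (hDnn k)
  constructor
  · rw [← mul_assoc, ← htel.tsum_eq, ← tsum_mul_left]
    exact (htel.summable.mul_left _).tsum_le_tsum lo hsum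
  · rw [← mul_assoc, ← htel.tsum_eq, ← tsum_mul_left]
    exact hsum.tsum_le_tsum hi (htel.summable.mul_left _)

lemma tendsto_tailSum_div {w : ℕ → ℝ} {A : ℝ} (hl0 : 0 < lam) (hl : lam < 1) (hb : 0 < b)
    (hA : 0 < A) (hw : (fun n : ℕ => w n) ~[atTop]
      fun n : ℕ => A * Real.exp (-(b / (1 - lam)) * (n : ℝ) ^ (1 - lam)))
    {ι : Type*} {l : Filter ι} {s : ι → ℝ} {j : ι → ℕ} (hs : ∀ᶠ i in l, 0 ≤ s i)
    (hs0 : Tendsto s l (𝓝 0)) (hj : Tendsto j l atTop) :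
    Tendsto (fun i => tailSum w (s i) (j i) / tailProfile lam b (s i) (j i)) l (𝓝 A) := by
  rw [Metric.tendsto_nhds]
  intro ε hε
  obtain ⟨j₀, s₀, hs₀, H⟩ := tailSum_bounds hl0 hl hb hA hw
    (ε := min 1 (ε / (2 * A))) (by positivity) (min_le_left _ _)
  filter_upwards [hs, hs0.eventually_le_const hs₀, hj.eventually_ge_atTop j₀,
    hj.eventually_gt_atTop 0] with i h1 h2 h3 h4
  obtain ⟨ha, hc⟩ := H (j i) h3 (s i) h1 h2
  have hp : 0 < tailProfile lam b (s i) (j i) := tailProfile_pos hb h1 (by exact_mod_cast h4)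
  set δ := min 1 (ε / (2 * A))
  have hδ : δ * A ≤ ε / 2 := by
    calc δ * A ≤ ε / (2 * A) * A := by gcongr; exact min_le_right _ _
      _ = ε / 2 := by field_simp
  rw [Real.dist_eq, abs_lt]
  constructor
  · rw [lt_sub_iff_add_lt, lt_div_iff₀ hp]
    nlinarith
  · rw [sub_lt_iff_lt_add, div_lt_iff₀ hp]
    nlinarith

/-- Since `ψ_s'(γ) γ ≥ b γ^{1-λ}`, displacements of order `1/ψ_s'(γ)` are negligible against `γ`. -/
lemma tendsto_tiltSlope_mul_self (hl : lam < 1) (hb : 0 < b) {ι : Type*} {l : Filter ι}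
    {s γ : ι → ℝ} (hs : ∀ᶠ i in l, 0 ≤ s i) (hγ : Tendsto γ l atTop) :
    Tendsto (fun i => tiltSlope lam b (s i) (γ i) * γ i) l atTop := by
  have hpos := hγ.eventually_gt_atTop 0
  have h1 : Tendsto (fun i => b * γ i ^ (1 - lam)) l atTop :=
    ((tendsto_rpow_atTop (by linarith)).comp hγ).const_mul_atTop hb
  refine tendsto_atTop_mono' _ ?_ h1
  filter_upwards [hs, hpos] with i h1 h2
  have : b * γ i ^ (1 - lam) = b * γ i ^ (-lam) * γ i := by
    rw [show 1 - lam = -lam + 1 by ring, Real.rpow_add_one h2.ne']; ring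
  rw [this]
  unfold tiltSlope
  nlinarith

/-- Shifting the argument by `δ` with `δ ψ_s'(γ) → x` changes the tail profile by `e^{-x}`. -/
lemma tendsto_tailProfile_shift (hl : lam < 1) (hb : 0 < b)
    {ι : Type*} {l : Filter ι} {s γ δ : ι → ℝ} {x : ℝ} (hs : ∀ᶠ i in l, 0 ≤ s i)
    (hγ : Tendsto γ l atTop)
    (hδ : Tendsto (fun i => δ i * tiltSlope lam b (s i) (γ i)) l (𝓝 x)) :
    Tendsto (fun i => tailProfile lam b (s i) (γ i + δ i) / tailProfile lam b (s i) (γ i)) l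
      (𝓝 (Real.exp (-x))) := by
  have hpos := hγ.eventually_gt_atTop 0
  have hsg := tendsto_tiltSlope_mul_self (lam := lam) hl hb hs hγ
  set θ : ι → ℝ := fun i => δ i / γ i with hθ
  have hθ0 : Tendsto θ l (𝓝 0) := by
    have := hδ.mul hsg.inv_tendsto_atTop
    rw [mul_zero] at this
    refine this.congr' ?_
    filter_upwards [hs, hpos] with i h1 h2
    have := (tiltSlope_pos (lam := lam) hb h1 h2).ne'
    simp only [Pi.inv_apply, hθ]
    field_simp
  have hsplit : ∀ᶠ i in l, γ i + δ i = γ i * (1 + θ i) := by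
    filter_upwards [hpos] with i h2
    simp only [hθ]; field_simp
  have hθ1 : ∀ᶠ i in l, 0 < 1 + θ i := by
    filter_upwards [hθ0.eventually_const_lt (show (-1 : ℝ) < 0 by norm_num)] with i hi
    linarith
  -- the exponent
  have hexp : Tendsto (fun i => tiltExponent lam b (s i) (γ i + δ i) -
      tiltExponent lam b (s i) (γ i)) l (𝓝 x) := by
    have hder : HasDerivAt (fun u : ℝ => (1 + u) ^ (1 - lam)) (1 - lam) 0 := by
      have := (Real.hasDerivAt_rpow_const (x := 1 + 0) (p := 1 - lam)
        (Or.inl (by norm_num))).comp_const_add 1 0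
      simpa using this
    have ho : (fun i => (1 + θ i) ^ (1 - lam) - 1 - θ i * (1 - lam)) =o[l] θ := by
      have := hder.isLittleO.comp_tendsto hθ0
      simpa [Function.comp_def] using this
    -- The Taylor error of `(1+θ)^{1-λ}` is `o(θ)` and gets multiplied by `γ^{1-λ}`; the product
    -- `γ^{1-λ} θ = γ^{-λ} δ` is at most `|δ| ψ_s'(γ) / b` in size, hence bounded. The linear term
    -- `s t` contributes no error.
    have hbig : (fun i => γ i ^ (1 - lam) * θ i) =O[l] (fun _ => (1 : ℝ)) := by
      have h1 : (fun i => γ i ^ (1 - lam) * θ i) =O[l]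
          fun i => δ i * tiltSlope lam b (s i) (γ i) := by
        refine IsBigO.of_bound (1 / b) ?_
        filter_upwards [hs, hpos] with i h1 h2
        have h3 : γ i ^ (1 - lam) * θ i = γ i ^ (-lam) * δ i := by
          rw [show 1 - lam = -lam + 1 by ring, Real.rpow_add_one h2.ne']
          simp only [hθ]; field_simp
        have h4 : 0 < γ i ^ (-lam) := Real.rpow_pos_of_pos h2 _
        rw [h3, norm_mul, norm_mul, Real.norm_of_nonneg h4.le,
          Real.norm_of_nonneg (tiltSlope_pos hb h1 h2).le]
        unfold tiltSlope
        rw [div_mul_eq_mul_div, le_div_iff₀ hb]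
        have := norm_nonneg (δ i)
        nlinarith [mul_nonneg this h1]
      exact h1.trans (hδ.isBigO_one ℝ)
    have hz : Tendsto (fun i => b / (1 - lam) * (γ i ^ (1 - lam) *
        ((1 + θ i) ^ (1 - lam) - 1 - θ i * (1 - lam)))) l (𝓝 0) := by
      have h1 := ((isBigO_refl (fun i => γ i ^ (1 - lam)) l).mul_isLittleO ho).trans_isBigO hbig
      have h2 := (isLittleO_one_iff ℝ).1 h1
      simpa using h2.const_mul (b / (1 - lam))
    have := hz.add hδ
    rw [zero_add] at this
    refine this.congr' ?_
    filter_upwards [hs, hpos, hsplit, hθ1] with i h1 h2 h3 h4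
    have h5 : δ i = θ i * γ i := by simp only [hθ]; field_simp
    unfold tiltExponent tiltSlope
    rw [h3, Real.mul_rpow h2.le h4.le, h5]
    have h6 : γ i * γ i ^ (-lam) = γ i ^ (1 - lam) := by
      rw [show 1 - lam = -lam + 1 by ring, Real.rpow_add_one h2.ne']; ring
    have h7 : θ i * γ i * (b * γ i ^ (-lam) + s i) =
        θ i * b * γ i ^ (1 - lam) + θ i * γ i * s i := by rw [← h6]; ring
    rw [h7]
    have h8 : 1 - lam ≠ 0 := by linarith
    field_simp
    ring
  have hslope : Tendsto (fun i => tiltSlope lam b (s i) (γ i + δ i) /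
      tiltSlope lam b (s i) (γ i)) l (𝓝 1) := by
    have h1 : Tendsto (fun i => (1 + θ i) ^ (-lam) - 1) l (𝓝 0) := by
      have : Tendsto (fun i => 1 + θ i) l (𝓝 1) := by simpa using hθ0.const_add 1
      have := this.rpow_const (p := -lam) (Or.inl one_ne_zero)
      simpa using this.sub_const 1
    -- The share of `b γ^{-λ}` in the slope lies in `[0, 1]`, so the slope ratio is at least as
    -- close to 1 as `(1+θ)^{-λ}`, whatever `s` is.
    have h2 : Tendsto (fun i => b * γ i ^ (-lam) / tiltSlope lam b (s i) (γ i) *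
        ((1 + θ i) ^ (-lam) - 1)) l (𝓝 0) := by
      refine squeeze_zero_norm' ?_ (tendsto_norm_zero.comp h1)
      filter_upwards [hs, hpos] with i h1 h2
      have h3 := tiltSlope_pos (lam := lam) hb h1 h2
      have h4 : 0 < γ i ^ (-lam) := Real.rpow_pos_of_pos h2 _
      rw [norm_mul]
      refine mul_le_of_le_one_left (norm_nonneg _) ?_
      rw [Real.norm_of_nonneg (by positivity), div_le_one h3]
      unfold tiltSlope; linarith
    have h3 := h2.const_add 1
    rw [add_zero] at h3
    refine h3.congr' ?_
    filter_upwards [hs, hpos, hsplit, hθ1] with i h1 h2 h3 h4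
    have h5 := tiltSlope_pos (lam := lam) hb h1 h2
    rw [eq_div_iff h5.ne', add_mul, div_mul_eq_mul_div, div_mul_cancel₀ _ h5.ne']
    unfold tiltSlope
    rw [h3, Real.mul_rpow h2.le h4.le]
    ring
  have hfin := ((Real.continuous_exp.tendsto _).comp hexp.neg).div hslope one_ne_zero
  rw [div_one] at hfin
  refine hfin.congr fun i => ?_
  simp only [Function.comp, tailProfile, Pi.div_apply]
  rw [div_div_div_comm, ← Real.exp_sub]
  congr 2
  ring

lemma tendsto_tiltSlope (hl0 : 0 < lam) {ι : Type*} {l : Filter ι} {s t : ι → ℝ}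
    (hs0 : Tendsto s l (𝓝 0)) (ht : Tendsto t l atTop) :
    Tendsto (fun i => tiltSlope lam b (s i) (t i)) l (𝓝 0) := by
  have := (((tendsto_rpow_neg_atTop hl0).comp ht).const_mul b).add hs0
  simpa [tiltSlope, Function.comp_def] using this

/-- `∑_{n > t} w(n) e^{-s n} ≃ A exp(-ψ_s(t)) / ψ_s'(t)` as `t → ∞` and `s → 0`. -/
lemma tendsto_tailSum_floor_div {w : ℕ → ℝ} {A : ℝ} (hl0 : 0 < lam) (hl : lam < 1) (hb : 0 < b)
    (hA : 0 < A) (hw : (fun n : ℕ => w n) ~[atTop]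
      fun n : ℕ => A * Real.exp (-(b / (1 - lam)) * (n : ℝ) ^ (1 - lam)))
    {ι : Type*} {l : Filter ι} {s t : ι → ℝ} (hs : ∀ᶠ i in l, 0 ≤ s i)
    (hs0 : Tendsto s l (𝓝 0)) (ht : Tendsto t l atTop) :
    Tendsto (fun i => tailSum w (s i) ⌊t i⌋₊ / tailProfile lam b (s i) (t i)) l (𝓝 A) := by
  have hfl : Tendsto (fun i => ⌊t i⌋₊) l atTop := tendsto_nat_floor_atTop.comp ht
  have h1 := tendsto_tailSum_div hl0 hl hb hA hw hs hs0 hfl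
  have hsl := tendsto_tiltSlope (b := b) hl0 hs0 ht
  -- Rounding down moves the argument by at most 1 while the slope tends to 0, so this is a shift
  -- with `x = 0`.
  have h2 := tendsto_tailProfile_shift (x := 0) (δ := fun i => ⌊t i⌋₊ - t i) hl hb hs ht (by
    refine squeeze_zero_norm' ?_ hsl
    filter_upwards [hs, ht.eventually_gt_atTop 0] with i h1 h2
    have h3 := tiltSlope_pos (lam := lam) hb h1 h2
    rw [norm_mul, Real.norm_of_nonneg h3.le]
    refine mul_le_of_le_one_left h3.le ?_
    rw [Real.norm_eq_abs, abs_le]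
    constructor
    · linarith [Nat.lt_floor_add_one (t i)]
    · linarith [Nat.floor_le h2.le])
  have h3 := h1.mul h2
  simp only [neg_zero, Real.exp_zero, mul_one, add_sub_cancel] at h3
  refine h3.congr' ?_
  filter_upwards [hs, hfl.eventually_gt_atTop 0] with i h1 h2
  have : tailProfile lam b (s i) (⌊t i⌋₊) ≠ 0 := (tailProfile_pos hb h1 (by exact_mod_cast h2)).ne'
  rw [div_mul_div_cancel₀ this]

end Tail

/-! ### Centring and width: solving for a given level of the profile. -/

section Scale

variable {lam b s t : ℝ}

lemma exists_tailProfile_eq (hl : lam < 1) (hb : 0 < b) (hs : 0 ≤ s) {t₀ v : ℝ} (ht₀ : 0 < t₀)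
    (hv : 0 < v) (hvt : v ≤ tailProfile lam b s t₀) :
    ∃ γ ≥ t₀, tailProfile lam b s γ = v := by
  obtain ⟨T, hT, hTt⟩ := (((tendsto_tailProfile_atTop hl hb hs).eventually_lt_const hv).and
    (eventually_ge_atTop t₀)).exists
  have hc : ContinuousOn (tailProfile lam b s) (Set.Icc t₀ T) := fun x hx =>
    (hasDerivAt_tailProfile hl hb hs (ht₀.trans_le hx.1)).continuousAt.continuousWithinAt
  obtain ⟨γ, hγ, h⟩ := intermediate_value_Icc' hTt hc ⟨hT.le, hvt⟩
  exact ⟨γ, hγ.1, h⟩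

/-- A floor uniform in `s ∈ [0,1]` and `t ∈ [1,T]`. It supplies a starting level at `t = 1` for the
intermediate value theorem, and it shows that points where the profile tends to 0 must escape to
infinity. -/
lemma le_tailProfile (hl0 : 0 < lam) (hl : lam < 1) (hb : 0 < b) (hs : 0 ≤ s) (hs1 : s ≤ 1)
    {T : ℝ} (ht : 1 ≤ t) (htT : t ≤ T) :
    Real.exp (-tiltExponent lam b 1 T) / (b + 1) ≤ tailProfile lam b s t := by
  have ht0 : 0 < t := by linarith
  apply div_le_div₀ (Real.exp_pos _).le _ (tiltSlope_pos hb hs ht0)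
  · unfold tiltSlope
    have := Real.rpow_le_one_of_one_le_of_nonpos ht (by linarith : -lam ≤ 0)
    nlinarith
  · apply Real.exp_le_exp.2
    have h1 := tiltExponent_mono (b := b) hl hb hs ht0.le htT
    have h2 : tiltExponent lam b s T ≤ tiltExponent lam b 1 T := by
      unfold tiltExponent
      nlinarith
    linarith

lemma tendsto_atTop_of_tailProfile (hl0 : 0 < lam) (hl : lam < 1) (hb : 0 < b)
    {ι : Type*} {l : Filter ι} {s γ : ι → ℝ} (hs : ∀ᶠ i in l, 0 ≤ s i)
    (hs0 : Tendsto s l (𝓝 0)) (hγ1 : ∀ᶠ i in l, 1 ≤ γ i)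
    (hγ : Tendsto (fun i => tailProfile lam b (s i) (γ i)) l (𝓝 0)) : Tendsto γ l atTop := by
  rw [tendsto_atTop]
  intro T
  have hc : 0 < Real.exp (-tiltExponent lam b 1 T) / (b + 1) := by positivity
  filter_upwards [hs, hs0.eventually_le_const one_pos, hγ1, hγ.eventually_lt_const hc]
    with i h1 h2 h3 h4
  by_contra! h
  exact absurd (le_tailProfile hl0 hl hb h1 h2 h3 h.le) (not_le.2 h4)

lemma exists_scale (hl0 : 0 < lam) (hl : lam < 1) (hb : 0 < b)
    {ι : Type*} {l : Filter ι} [l.NeBot] {s v : ι → ℝ} (hs : ∀ᶠ i in l, 0 ≤ s i)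
    (hs0 : Tendsto s l (𝓝 0)) (hv : ∀ᶠ i in l, 0 < v i) (hv0 : Tendsto v l (𝓝 0)) :
    ∃ γ : ι → ℝ, Tendsto γ l atTop ∧ ∀ᶠ i in l, tailProfile lam b (s i) (γ i) = v i := by
  have hc : 0 < Real.exp (-tiltExponent lam b 1 1) / (b + 1) := by positivity
  have h : ∀ᶠ i in l, ∃ γ ≥ 1, tailProfile lam b (s i) γ = v i := by
    filter_upwards [hs, hs0.eventually_le_const one_pos, hv, hv0.eventually_lt_const hc]
      with i h1 h2 h3 h4
    exact exists_tailProfile_eq hl hb h1 one_pos h3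
      (h4.le.trans (le_tailProfile hl0 hl hb h1 h2 le_rfl le_rfl))
  obtain ⟨γ, hγ⟩ := h.choice
  have h2 : ∀ᶠ i in l, tailProfile lam b (s i) (γ i) = v i := hγ.mono fun i hi => hi.2
  exact ⟨γ, tendsto_atTop_of_tailProfile hl0 hl hb hs hs0 (hγ.mono fun i hi => hi.1)
    (hv0.congr' (h2.mono fun i hi => hi.symm)), h2⟩

/-- Beyond the `t₀` where the curvature correction drops below 1 the untilted profile is antitone,
so strictly decreasing levels are attained at strictly increasing points. `v₀` is the level at `t₀`.
-/
lemma exists_strictMono_scale (hl0 : 0 < lam) (hl : lam < 1) (hb : 0 < b) :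
    ∃ v₀ > 0, ∀ v : ℕ → ℝ, (∀ n, 0 < v n) → (∀ n, v n ≤ v₀) → StrictAnti v →
      Tendsto v atTop (𝓝 0) →
      ∃ γ : ℕ → ℝ, StrictMono γ ∧ (∀ n, 1 ≤ γ n) ∧ Tendsto γ atTop atTop ∧
        ∀ n, tailProfile lam b 0 (γ n) = v n := by
  obtain ⟨t₀, ht1, ht₀⟩ : ∃ t₀ : ℝ, 1 ≤ t₀ ∧ lam / b * t₀ ^ (lam - 1) ≤ 1 := by
    have : Tendsto (fun t : ℝ => lam / b * t ^ (lam - 1)) atTop (𝓝 (lam / b * 0)) := by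
      have := tendsto_rpow_neg_atTop (by linarith : 0 < 1 - lam)
      simpa using Tendsto.const_mul (lam / b) this
    rw [mul_zero] at this
    exact ((eventually_ge_atTop 1).and (this.eventually_le_const one_pos)).exists
  have htpos : 0 < t₀ := by linarith
  have hanti : AntitoneOn (tailProfile lam b 0) (Set.Ici t₀) := by
    refine antitoneOn_of_deriv_nonpos (convex_Ici _) (fun x hx => (hasDerivAt_tailProfile hl hb
      le_rfl (htpos.trans_le hx)).continuousAt.continuousWithinAt) (fun x hx => ?_) fun x hx => ?_
    · rw [interior_Ici] at hx
      exact (hasDerivAt_tailProfile hl hb le_rfl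
        (htpos.trans hx)).differentiableAt.differentiableWithinAt
    · rw [interior_Ici] at hx
      have hx0 : 0 < x := htpos.trans hx
      rw [(hasDerivAt_tailProfile hl hb le_rfl hx0).deriv, neg_nonpos]
      refine mul_nonneg (Real.exp_pos _).le ?_
      have h1 := slope_curvature_le (s := 0) hl0 hb le_rfl hx0
      have h2 : lam / b * x ^ (lam - 1) ≤ lam / b * t₀ ^ (lam - 1) := by
        have := Real.rpow_le_rpow_of_nonpos htpos (le_of_lt hx) (by linarith : lam - 1 ≤ 0)
        gcongr
      linarith
  refine ⟨tailProfile lam b 0 t₀, tailProfile_pos hb le_rfl htpos, fun v hv hv₀ hva hv0 => ?_⟩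
  choose γ hγ hγv using fun n => exists_tailProfile_eq hl hb le_rfl htpos (hv n) (hv₀ n)
  refine ⟨γ, strictMono_nat_of_lt_succ fun n => ?_, fun n => ht1.trans (hγ n), ?_, hγv⟩
  · by_contra! h
    have := hanti (hγ (n + 1)) (hγ n) h
    rw [hγv, hγv] at this
    exact absurd (hva n.lt_succ_self) (not_lt.2 this)
  · exact tendsto_atTop_of_tailProfile (s := fun _ => 0) hl0 hl hb
      (Eventually.of_forall fun _ => le_rfl) tendsto_const_nhds
      (Eventually.of_forall fun n => ht1.trans (hγ n)) (hv0.congr fun n => (hγv n).symm)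

lemma tendsto_scale_shift_atTop (hl : lam < 1) (hb : 0 < b)
    {ι : Type*} {l : Filter ι} {s γ : ι → ℝ} (hs : ∀ᶠ i in l, 0 ≤ s i)
    (hγ : Tendsto γ l atTop) (x : ℝ) :
    Tendsto (fun i => γ i + x * (tiltSlope lam b (s i) (γ i))⁻¹) l atTop := by
  have h1 := (tendsto_tiltSlope_mul_self (lam := lam) hl hb hs hγ).inv_tendsto_atTop
  have h2 : Tendsto (fun i => 1 + x * (tiltSlope lam b (s i) (γ i) * γ i)⁻¹) l (𝓝 1) := by
    simpa using (h1.const_mul x).const_add 1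
  refine (hγ.atTop_mul_pos one_pos h2).congr' ?_
  filter_upwards [hs, hγ.eventually_gt_atTop 0] with i h3 h4
  have := (tiltSlope_pos (lam := lam) hb h3 h4).ne'
  field_simp

/-- Gumbel limit of the tilted tail sums at the scale where the profile equals `v`. -/
lemma tendsto_tailSum_scale {w : ℕ → ℝ} {A : ℝ} (hl0 : 0 < lam) (hl : lam < 1) (hb : 0 < b)
    (hA : 0 < A) (hw : (fun n : ℕ => w n) ~[atTop]
      fun n : ℕ => A * Real.exp (-(b / (1 - lam)) * (n : ℝ) ^ (1 - lam)))
    {ι : Type*} {l : Filter ι} {s γ v : ι → ℝ} (hs : ∀ᶠ i in l, 0 ≤ s i)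
    (hs0 : Tendsto s l (𝓝 0)) (hγ : Tendsto γ l atTop)
    (hv : ∀ᶠ i in l, tailProfile lam b (s i) (γ i) = v i) (x : ℝ) :
    Tendsto (fun i => tailSum w (s i) ⌊γ i + x * (tiltSlope lam b (s i) (γ i))⁻¹⌋₊ / v i) l
      (𝓝 (A * Real.exp (-x))) := by
  have hu := tendsto_scale_shift_atTop (lam := lam) hl hb hs hγ x
  have h1 := tendsto_tailSum_floor_div hl0 hl hb hA hw hs hs0 hu
  have h2 := tendsto_tailProfile_shift (x := x)
    (δ := fun i => x * (tiltSlope lam b (s i) (γ i))⁻¹) hl hb hs hγ (by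
      refine tendsto_const_nhds.congr' ?_
      filter_upwards [hs, hγ.eventually_gt_atTop 0] with i h3 h4
      rw [inv_mul_cancel_right₀ (tiltSlope_pos hb h3 h4).ne'])
  refine (h1.mul h2).congr' ?_
  filter_upwards [hs, hu.eventually_gt_atTop 0, hv] with i h3 h4 h5
  rw [div_mul_div_cancel₀ (tailProfile_pos hb h3 h4).ne', h5]

/-- Tilting by `s` with `s t → κ` multiplies the tail beyond `t` by `e^{-κ}`. -/
lemma tendsto_tailSum_tilt {w : ℕ → ℝ} {A : ℝ} (hl0 : 0 < lam) (hl : lam < 1) (hb : 0 < b)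
    (hA : 0 < A) (hw : (fun n : ℕ => w n) ~[atTop]
      fun n : ℕ => A * Real.exp (-(b / (1 - lam)) * (n : ℝ) ^ (1 - lam)))
    {ι : Type*} {l : Filter ι} {s t : ι → ℝ} {κ : ℝ} (hs : ∀ᶠ i in l, 0 ≤ s i)
    (hs0 : Tendsto s l (𝓝 0)) (ht : Tendsto t l atTop)
    (hst : Tendsto (fun i => s i * t i) l (𝓝 κ)) :
    Tendsto (fun i => tailSum w (s i) ⌊t i⌋₊ / tailSum w 0 ⌊t i⌋₊) l (𝓝 (Real.exp (-κ))) := by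
  have h1 := tendsto_tailSum_floor_div hl0 hl hb hA hw hs hs0 ht
  have h2 := tendsto_tailSum_floor_div (s := fun _ => 0) hl0 hl hb hA hw
    (Eventually.of_forall fun _ => le_rfl) tendsto_const_nhds ht
  have h3 : Tendsto (fun i => tailProfile lam b (s i) (t i) / tailProfile lam b 0 (t i)) l
      (𝓝 (Real.exp (-κ))) := by
    -- The exponents differ by exactly `s t`; the slopes have ratio `1 + (s t) t^{λ-1} / b`, which
    -- tends to 1.
    have h4 : Tendsto (fun i => tiltSlope lam b (s i) (t i) / tiltSlope lam b 0 (t i)) l (𝓝 1) := by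
      have h5 : Tendsto (fun i => 1 + s i * t i * t i ^ (lam - 1) / b) l
          (𝓝 (1 + κ * 0 / b)) := by
        have := (tendsto_rpow_neg_atTop (by linarith : 0 < 1 - lam)).comp ht
        have h6 : Tendsto (fun i => t i ^ (lam - 1)) l (𝓝 0) := by
          simpa [Function.comp_def] using this
        exact ((hst.mul h6).div_const b).const_add 1
      rw [mul_zero, zero_div, add_zero] at h5
      refine h5.congr' ?_
      filter_upwards [ht.eventually_gt_atTop 0] with i h6
      unfold tiltSlope
      have h7 : 0 < t i ^ lam := Real.rpow_pos_of_pos h6 _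
      rw [Real.rpow_neg h6.le, Real.rpow_sub_one h6.ne']
      field_simp
      ring
    have h5 := ((Real.continuous_exp.tendsto _).comp hst.neg).div h4 one_ne_zero
    rw [div_one] at h5
    refine h5.congr fun i => ?_
    simp only [Function.comp, tailProfile, Pi.div_apply]
    rw [div_div_div_comm, ← Real.exp_sub]
    congr 2
    unfold tiltExponent; ring
  have h4 := (h1.div h2 hA.ne').mul h3
  rw [div_self hA.ne', one_mul] at h4
  refine h4.congr' ?_
  filter_upwards [hs, ht.eventually_gt_atTop 0] with i h6 h7
  have h8 := (tailProfile_pos (lam := lam) hb h6 h7).ne'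
  have h9 := (tailProfile_pos (lam := lam) (s := 0) hb le_rfl h7).ne'
  simp only [Pi.div_apply]
  field_simp

/-- Asymptotics of the critical scale. -/
lemma scale_isEquivalent (hl : lam < 1) (hb : 0 < b)
    {ι : Type*} {l : Filter ι} {γ a a' : ι → ℝ} (hγ : Tendsto γ l atTop)
    (hγa : ∀ᶠ i in l, tailProfile lam b 0 (γ i) = Real.exp (-a i)) (ha : a ~[l] a')
    (ha' : Tendsto a' l atTop) :
    γ ~[l] fun i => ((1 - lam) / b * a' i) ^ (1 / (1 - lam)) := by
  have h1l : 0 < 1 - lam := by linarith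
  have hc : 0 < b / (1 - lam) := div_pos hb h1l
  -- Taking logarithms of the defining equation leaves `b/(1-λ) γ^{1-λ}` plus terms of order `log
  -- γ`, which are negligible; the main term is then inverted.
  have haeq : ∀ᶠ i in l, a i = b / (1 - lam) * γ i ^ (1 - lam) +
      (Real.log b - lam * Real.log (γ i)) := by
    filter_upwards [hγa, hγ.eventually_gt_atTop 0] with i h1 h2
    have h3 := congrArg Real.log h1
    unfold tailProfile tiltExponent tiltSlope at h3
    have h4 := Real.rpow_pos_of_pos h2 (-lam)
    rw [Real.log_exp, Real.log_div (Real.exp_pos _).ne' (by positivity), Real.log_exp, add_zero,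
      Real.log_mul hb.ne' h4.ne', Real.log_rpow h2] at h3
    linarith
  have hpow : Tendsto (fun i => γ i ^ (1 - lam)) l atTop := (tendsto_rpow_atTop h1l).comp hγ
  have ho : (fun i => Real.log b - lam * Real.log (γ i)) =o[l]
      fun i => b / (1 - lam) * γ i ^ (1 - lam) := by
    refine IsLittleO.const_mul_right hc.ne' (IsLittleO.sub ?_ ?_)
    · exact isLittleO_const_left.2 (Or.inr (tendsto_norm_atTop_atTop.comp hpow))
    · exact ((isLittleO_log_rpow_atTop h1l).comp_tendsto hγ).const_mul_left lam
  have he : a' ~[l] fun i => b / (1 - lam) * γ i ^ (1 - lam) := by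
    refine ha.symm.trans (IsEquivalent.congr_left ?_ (haeq.mono fun i hi => hi.symm))
    exact IsEquivalent.refl.add_isLittleO ho
  have hr : Tendsto (fun i => a' i / (b / (1 - lam) * γ i ^ (1 - lam))) l (𝓝 1) := by
    refine (isEquivalent_iff_tendsto_one ?_).1 he
    filter_upwards [hγ.eventually_gt_atTop 0] with i h
    have := Real.rpow_pos_of_pos h (1 - lam)
    positivity
  have hr' := hr.rpow_const (p := 1 / (1 - lam)) (Or.inl one_ne_zero)
  rw [Real.one_rpow] at hr'
  refine IsEquivalent.symm ((isEquivalent_iff_tendsto_one ?_).2 (hr'.congr' ?_))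
  · filter_upwards [hγ.eventually_gt_atTop 0] with i h using h.ne'
  · filter_upwards [hγ.eventually_gt_atTop 0, ha'.eventually_ge_atTop 0] with i h h2
    have h3 : a' i / (b / (1 - lam) * γ i ^ (1 - lam)) =
        ((1 - lam) / b * a' i) / γ i ^ (1 - lam) := by
      have := (Real.rpow_pos_of_pos h (1 - lam)).ne'
      field_simp
    rw [h3, Real.div_rpow (by positivity) (by positivity), ← Real.rpow_mul h.le,
      mul_one_div_cancel h1l.ne', Real.rpow_one]
    rfl

end Scale

/-! ### Fourier inversion and decay of the characteristic function. -/

section LocalLimit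

/-- Mass that the product weight `∏ h(η_i)` under `m^L` gives to `{S_L = N}`. -/
noncomputable def totalMass (m : Measure ℕ) (h : ℕ → ℝ) (L N : ℕ) : ℝ :=
  ∫ η : Fin L → ℕ, {η | total η = N}.indicator (fun η => ∏ i, h (η i)) η ∂Measure.pi fun _ => m

/-- Fourier transform of the measure `h m` centred at `a`. -/
noncomputable def centredChar (m : Measure ℕ) (h : ℕ → ℝ) (a t : ℝ) : ℂ :=
  ∫ n, (h n : ℂ) * Complex.exp ((t * ((n : ℝ) - a) : ℝ) * Complex.I) ∂m

lemma integral_exp_int_mul_I (k : ℤ) :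
    ∫ t in -Real.pi..Real.pi, Complex.exp ((t * (k : ℝ) : ℝ) * Complex.I) =
      if k = 0 then 2 * (Real.pi : ℂ) else 0 := by
  split_ifs with h
  · subst h
    simp
    ring
  · have hc : (k : ℂ) * Complex.I ≠ 0 := mul_ne_zero (by exact_mod_cast h) Complex.I_ne_zero
    have h1 : ∀ t : ℝ, Complex.exp ((t * (k : ℝ) : ℝ) * Complex.I) =
        Complex.exp ((k : ℂ) * Complex.I * t) := fun t => by
      congr 1; push_cast; ring
    simp_rw [h1]
    rw [integral_exp_mul_complex hc, div_eq_zero_iff]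
    left
    rw [sub_eq_zero, Complex.exp_eq_exp_iff_exists_int]
    exact ⟨k, by push_cast; ring⟩

variable {m : Measure ℕ} [IsProbabilityMeasure m]

lemma integrable_of_abs_le {h : ℕ → ℝ} {C : ℝ} (hh : ∀ n, |h n| ≤ C) : Integrable h m :=
  Integrable.of_bound (measurable_of_countable h).aestronglyMeasurable C
    (Eventually.of_forall hh)

lemma continuous_centredChar {h : ℕ → ℝ} {C : ℝ} (hh : ∀ n, |h n| ≤ C) (a : ℝ) :
    Continuous (centredChar m h a) := by
  refine continuous_of_dominated (bound := fun _ => C) (fun t =>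
    (measurable_of_countable _).aestronglyMeasurable) (fun t => Eventually.of_forall fun n => ?_)
    (integrable_const _) (Eventually.of_forall fun n => by fun_prop)
  rw [norm_mul, Complex.norm_exp_ofReal_mul_I, mul_one]
  simpa using hh n

/-- The constraint `S_L = N` is the average of `e^{it(S_L - N)}` over a period. After Fubini the
product structure gives an `L`-th power, with `e^{-itN}` distributed over the sites by `L a = N`. -/
lemma totalMass_eq_integral {h : ℕ → ℝ} {C : ℝ} (hh : ∀ n, |h n| ≤ C) {L N : ℕ} {a : ℝ}
    (ha : L * a = N) :
    ((2 * Real.pi * totalMass m h L N : ℝ) : ℂ) =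
      ∫ t in -Real.pi..Real.pi, centredChar m h a t ^ L := by
  have hC : 0 ≤ C := (abs_nonneg _).trans (hh 0)
  have h1 : ∀ t : ℝ, centredChar m h a t ^ L = ∫ η : Fin L → ℕ,
      ((∏ i, h (η i) : ℝ) : ℂ) *
        Complex.exp ((t * (((total η : ℤ) - N : ℤ) : ℝ) : ℝ) * Complex.I)
        ∂Measure.pi fun _ => m := fun t => by
    have := integral_fintype_prod_eq_pow (ι := Fin L) (μ := m)
      (fun n : ℕ => (h n : ℂ) * Complex.exp ((t * ((n : ℝ) - a) : ℝ) * Complex.I))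
    rw [Fintype.card_fin] at this
    rw [centredChar, ← this]
    refine integral_congr_ae (Eventually.of_forall fun η => ?_)
    simp only [Finset.prod_mul_distrib]
    rw [← Complex.exp_sum]
    congr 1
    · push_cast; rfl
    · congr 1
      rw [← Finset.sum_mul, ← Complex.ofReal_sum, ← Finset.mul_sum, Finset.sum_sub_distrib]
      simp [total, ha]
  simp_rw [h1]
  rw [intervalIntegral_integral_swap]
  · rw [totalMass, Complex.ofReal_mul, ← integral_complex_ofReal, ← integral_const_mul]
    refine integral_congr_ae (Eventually.of_forall fun η => ?_)
    simp only
    rw [intervalIntegral.integral_const_mul, integral_exp_int_mul_I]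
    by_cases hη : total η = N
    · rw [Set.indicator_of_mem (show η ∈ {η | total η = N} from hη), if_pos (by simp [hη])]
      push_cast; ring
    · rw [Set.indicator_of_notMem (show η ∉ {η | total η = N} from hη), if_neg]
      · simp
      · rw [sub_eq_zero]; exact_mod_cast hη
  · have : IsFiniteMeasure (volume.restrict (Set.uIoc (-Real.pi) Real.pi)) :=
      ⟨by simp [Set.uIoc, Real.volume_Ioc]⟩
    refine Integrable.of_bound (C := C ^ L) ?_ (Eventually.of_forall fun p => ?_)
    · refine Measurable.aestronglyMeasurable ?_
      refine measurable_from_prod_countable_left fun η => ?_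
      simp only [Function.uncurry]
      fun_prop
    · simp only [Function.uncurry]
      rw [norm_mul, Complex.norm_exp_ofReal_mul_I, mul_one, Complex.norm_real, Real.norm_eq_abs,
        Finset.abs_prod]
      calc _ ≤ ∏ _i : Fin L, C := Finset.prod_le_prod (fun _ _ => abs_nonneg _) fun i _ => hh _
        _ = C ^ L := by simp

/-- Substitution `t = v/√L`. The growing window is written as an indicator so that dominated
convergence can be applied on all of `ℝ`. -/
lemma sqrt_mul_totalMass {h : ℕ → ℝ} {C : ℝ} (hh : ∀ n, |h n| ≤ C) {L N : ℕ} (hL : 0 < L) :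
    ((2 * Real.pi * (√L * totalMass m h L N) : ℝ) : ℂ) =
      ∫ v : ℝ, (Set.Ioc (-(√L * Real.pi)) (√L * Real.pi)).indicator
        (fun v => centredChar m h (N / L) (v / √L) ^ L) v := by
  have hL0 : (0 : ℝ) < L := by exact_mod_cast hL
  have hs : 0 < √(L : ℝ) := Real.sqrt_pos.2 hL0
  have h1 := totalMass_eq_integral (m := m) hh (L := L) (N := N) (a := N / L) (by field_simp)
  rw [integral_indicator measurableSet_Ioc, ← intervalIntegral.integral_of_le (by
    have := Real.pi_pos; nlinarith [mul_pos hs this])]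
  rw [intervalIntegral.integral_comp_div (fun t => centredChar m h (N / L) t ^ L) hs.ne', neg_div,
    mul_div_cancel_left₀ _ hs.ne', ← h1, Complex.real_smul]
  push_cast; ring

/-- Gaussian decay of the characteristic function on `[-π, π]`. -/
lemma norm_centredChar_le {h : ℕ → ℝ} {C : ℝ} (hh : ∀ n, |h n| ≤ C) (h0 : ∀ n, 0 ≤ h n)
    (h01 : 1 / 2 ≤ h 0) (h11 : 1 / 2 ≤ h 1) (hint : ∫ n, h n ∂m ≤ 1) {δ : ℝ} (hδ : 0 ≤ δ)
    (hm0 : δ ≤ m.real {0}) (hm1 : δ ≤ m.real {1}) (a : ℝ) {t : ℝ} (ht : |t| ≤ Real.pi) :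
    ‖centredChar m h a t‖ ≤ Real.exp (-(δ / (2 * Real.pi ^ 2)) * t ^ 2) := by
  set e : ℕ → ℂ := fun n => Complex.exp ((t * ((n : ℝ) - a) : ℝ) * Complex.I) with he
  have hen : ∀ n, ‖e n‖ = 1 := fun n => Complex.norm_exp_ofReal_mul_I _
  -- Only the sites 0 and 1 of the state space are used for cancellation: half of each atom is split
  -- off, and the rest is bounded by its mass.
  set p : ℕ → ℝ := fun n => ({0} : Set ℕ).indicator (fun _ => 1 / 2) n +
    ({1} : Set ℕ).indicator (fun _ => 1 / 2) n with hp
  have hp0 : ∀ n, 0 ≤ p n := fun n => add_nonneg (Set.indicator_nonneg (by norm_num) _)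
    (Set.indicator_nonneg (by norm_num) _)
  have hph : ∀ n, p n ≤ h n := by
    intro n
    rcases n with _ | _ | n
    · simpa [hp] using h01
    · simpa [hp] using h11
    · simpa [hp] using h0 (n + 2)
  have hpC : ∀ n, |p n| ≤ C := fun n => by
    rw [abs_of_nonneg (hp0 n)]; exact (hph n).trans ((le_abs_self _).trans (hh n))
  have hi : ∀ {f : ℕ → ℝ}, (∀ n, |f n| ≤ C) → Integrable (fun n => (f n : ℂ) * e n) m :=
    fun {f} hf => Integrable.of_bound (measurable_of_countable _).aestronglyMeasurable C
      (Eventually.of_forall fun n => by rw [norm_mul, hen, mul_one]; simpa using hf n)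
  have hsplit : centredChar m h a t =
      ∫ n, ((h n - p n : ℝ) : ℂ) * e n ∂m + ∫ n, (p n : ℂ) * e n ∂m := by
    have hd : Integrable (fun n => ((h n - p n : ℝ) : ℂ) * e n) m := by
      refine ((hi hh).sub (hi hpC)).congr (Eventually.of_forall fun n => ?_)
      simp only [Pi.sub_apply]; push_cast; ring
    rw [← integral_add hd (hi hpC), centredChar]
    refine integral_congr_ae (Eventually.of_forall fun n => ?_)
    simp only [he]; push_cast; ring
  have hb1 : ‖∫ n, ((h n - p n : ℝ) : ℂ) * e n ∂m‖ ≤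
      1 - (m.real {0} + m.real {1}) / 2 := by
    refine (norm_integral_le_integral_norm _).trans ?_
    have h1 : ∫ n, ‖((h n - p n : ℝ) : ℂ) * e n‖ ∂m = ∫ n, (h n - p n) ∂m := by
      refine integral_congr_ae (Eventually.of_forall fun n => ?_)
      simp only
      rw [norm_mul, hen, mul_one, Complex.norm_real, Real.norm_of_nonneg (sub_nonneg.2 (hph n))]
    have h2 : ∫ n, p n ∂m = (m.real {0} + m.real {1}) / 2 := by
      simp only [hp]
      rw [integral_add ((integrable_const _).indicator (measurableSet_singleton _))
        ((integrable_const _).indicator (measurableSet_singleton _)),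
        integral_indicator_const _ (measurableSet_singleton _),
        integral_indicator_const _ (measurableSet_singleton _)]
      simp only [smul_eq_mul]; ring
    rw [h1, integral_sub (integrable_of_abs_le hh) (integrable_of_abs_le hpC), h2]
    linarith
  have hval : ∫ n, (p n : ℂ) * e n ∂m = (m.real {0} / 2 : ℝ) * e 0 + (m.real {1} / 2 : ℝ) * e 1 := by
    have h1 : ∀ n, (p n : ℂ) * e n = ({0} : Set ℕ).indicator (fun _ => e 0 / 2) n +
        ({1} : Set ℕ).indicator (fun _ => e 1 / 2) n := by
      intro n
      rcases n with _ | _ | n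
      · simp [hp]; ring
      · simp [hp]; ring
      · simp [hp]
    simp_rw [h1]
    rw [integral_add ((integrable_const _).indicator (measurableSet_singleton _))
        ((integrable_const _).indicator (measurableSet_singleton _)),
        integral_indicator_const _ (measurableSet_singleton _),
        integral_indicator_const _ (measurableSet_singleton _)]
    simp only [Complex.real_smul]
    push_cast; ring
  have he01 : ‖e 0 + e 1‖ ≤ 2 - t ^ 2 / Real.pi ^ 2 := by
    -- The two phases differ by the angle `t`, so their sum has modulus `2 cos (t/2)`; a quadratic
    -- bound on the cosine holds on the whole range `|t| ≤ π`.
    have h1 : e 0 + e 1 = Complex.exp ((t * (1 / 2 - a) : ℝ) * Complex.I) *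
        ((2 * Real.cos (t / 2) : ℝ) : ℂ) := by
      have h2 : ((2 * Real.cos (t / 2) : ℝ) : ℂ) = 2 * Complex.cos ((t / 2 : ℝ) : ℂ) := by
        push_cast; rfl
      simp only [he]
      rw [h2, Complex.two_cos, mul_add,
        ← Complex.exp_add, ← Complex.exp_add, add_comm]
      congr 2
      · push_cast; ring
      · push_cast; ring
    have ht2 : |t / 2| ≤ Real.pi / 2 := by rw [abs_div, abs_two]; linarith
    have hcos : 0 ≤ Real.cos (t / 2) :=
      Real.cos_nonneg_of_mem_Icc ⟨(abs_le.1 ht2).1, (abs_le.1 ht2).2⟩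
    rw [h1, norm_mul, Complex.norm_exp_ofReal_mul_I, one_mul, Complex.norm_real,
      Real.norm_of_nonneg (by positivity)]
    have := Real.cos_le_one_sub_mul_cos_sq (x := t / 2) (by linarith [Real.pi_pos])
    have h3 : 2 / Real.pi ^ 2 * (t / 2) ^ 2 = t ^ 2 / Real.pi ^ 2 / 2 := by ring
    rw [h3] at this
    linarith
  have hb2 : ‖∫ n, (p n : ℂ) * e n ∂m‖ ≤
      (m.real {0} + m.real {1}) / 2 - δ / 2 * (t ^ 2 / Real.pi ^ 2) := by
    -- Only the common part `δ/2` of the two atoms is paired; the excesses are estimated trivially.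
    have h1 : ∫ n, (p n : ℂ) * e n ∂m = ((m.real {0} - δ) / 2 : ℝ) * e 0 +
        ((m.real {1} - δ) / 2 : ℝ) * e 1 + (δ / 2 : ℝ) * (e 0 + e 1) := by
      rw [hval]; push_cast; ring
    rw [h1]
    refine (norm_add₃_le).trans ?_
    rw [norm_mul, norm_mul, norm_mul, hen, hen, Complex.norm_real, Complex.norm_real,
      Complex.norm_real, Real.norm_of_nonneg (by linarith), Real.norm_of_nonneg (by linarith),
      Real.norm_of_nonneg (by linarith)]
    nlinarith [mul_le_mul_of_nonneg_left he01 (by linarith : 0 ≤ δ / 2)]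
  rw [hsplit]
  refine (norm_add_le _ _).trans ?_
  have := Real.add_one_le_exp (-(δ / (2 * Real.pi ^ 2)) * t ^ 2)
  have h3 : -(δ / (2 * Real.pi ^ 2)) * t ^ 2 = -(δ / 2 * (t ^ 2 / Real.pi ^ 2)) := by
    have := Real.pi_pos; field_simp
  rw [h3] at this ⊢
  linarith

/-- Valid for all real `θ`, which is what an integrable majorant requires: in its use `θ` is
unbounded in the occupation number. -/
lemma norm_exp_mul_I_sub_le (θ : ℝ) :
    ‖Complex.exp (θ * Complex.I) - 1 - θ * Complex.I‖ ≤ 2 * θ ^ 2 := by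
  by_cases h : |θ| ≤ 1
  · have := Complex.norm_exp_sub_one_sub_id_le (x := θ * Complex.I) (by simpa using h)
    rw [norm_mul, Complex.norm_I, mul_one, Complex.norm_real, Real.norm_eq_abs, sq_abs] at this
    nlinarith [sq_nonneg θ]
  · push Not at h
    have h1 := Real.norm_exp_I_mul_ofReal_sub_one_le (x := θ)
    rw [mul_comm, Real.norm_eq_abs] at h1
    have h2 : ‖(θ : ℂ) * Complex.I‖ = |θ| := by simp
    have h3 := norm_sub_le (Complex.exp (θ * Complex.I) - 1) (θ * Complex.I)
    rw [h2] at h3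
    have h4 : |θ| ^ 2 = θ ^ 2 := sq_abs θ
    nlinarith

lemma tendsto_mul_exp_mul_I_sub {θ : ℕ → ℝ} {c : ℝ}
    (hθ : Tendsto (fun L : ℕ => √L * θ L) atTop (𝓝 c)) :
    Tendsto (fun L : ℕ => (L : ℂ) *
      (Complex.exp (θ L * Complex.I) - 1 - θ L * Complex.I)) atTop (𝓝 (-(c ^ 2 / 2 : ℝ))) := by
  have hsq : Tendsto (fun L : ℕ => √(L : ℝ)) atTop atTop :=
    Real.tendsto_sqrt_atTop.comp tendsto_natCast_atTop_atTop
  have hθ0 : Tendsto θ atTop (𝓝 0) := by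
    have := hθ.mul hsq.inv_tendsto_atTop
    rw [mul_zero] at this
    refine this.congr' ?_
    filter_upwards [eventually_gt_atTop 0] with L hL
    have : √(L : ℝ) ≠ 0 := (Real.sqrt_pos.2 (by exact_mod_cast hL)).ne'
    simp only [Pi.inv_apply]
    field_simp
  have hL2 : Tendsto (fun L : ℕ => (L : ℝ) * θ L ^ 2) atTop (𝓝 (c ^ 2)) := by
    refine (hθ.pow 2).congr fun L => ?_
    rw [mul_pow, Real.sq_sqrt (Nat.cast_nonneg _)]
  have hmain : Tendsto (fun L : ℕ => ((-(L * θ L ^ 2 / 2) : ℝ) : ℂ)) atTop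
      (𝓝 ((-(c ^ 2 / 2) : ℝ) : ℂ)) :=
    (Complex.continuous_ofReal.tendsto _).comp (hL2.div_const 2).neg
  have herr : Tendsto (fun L : ℕ => (L : ℂ) *
      (Complex.exp (θ L * Complex.I) - 1 - θ L * Complex.I) - ((-(L * θ L ^ 2 / 2) : ℝ) : ℂ))
      atTop (𝓝 0) := by
    have h1 : Tendsto (fun L : ℕ => (L : ℝ) * θ L ^ 2 * |θ L|) atTop (𝓝 0) := by
      simpa using hL2.mul hθ0.abs
    refine squeeze_zero_norm' ?_ h1
    filter_upwards [hθ0.abs.eventually_le_const (by simp : |(0 : ℝ)| < 1)] with L hL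
    have h2 := Complex.exp_bound (x := θ L * Complex.I) (by simpa using hL) (n := 3) (by norm_num)
    have h3 : (L : ℂ) * (Complex.exp (θ L * Complex.I) - 1 - θ L * Complex.I) -
        ((-(L * θ L ^ 2 / 2) : ℝ) : ℂ) = L * (Complex.exp (θ L * Complex.I) -
          ∑ k ∈ Finset.range 3, (θ L * Complex.I) ^ k / (k.factorial : ℂ)) := by
      simp only [Finset.sum_range_succ, Finset.sum_range_zero, Nat.factorial, mul_pow,
        Complex.I_sq]
      push_cast; ring
    rw [h3, norm_mul, Complex.norm_natCast, mul_assoc]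
    refine mul_le_mul_of_nonneg_left (h2.trans ?_) (Nat.cast_nonneg _)
    rw [norm_mul, Complex.norm_I, mul_one, Complex.norm_real, Real.norm_eq_abs]
    have h5 : |θ L| ^ 3 = θ L ^ 2 * |θ L| := by rw [pow_succ, sq_abs]
    rw [h5]
    refine mul_le_of_le_one_right (by positivity) ?_
    norm_num [Nat.factorial]
  have := herr.add hmain
  rw [zero_add] at this
  simpa using this

end LocalLimit

/-! ### The local limit theorem for triangular arrays. -/

section LocalLimit

variable {m : Measure ℕ} [IsProbabilityMeasure m]

lemma integrable_of_sq_bound (hm2 : Integrable (fun n : ℕ => (n : ℝ) ^ 2) m) {f : ℕ → ℝ} {C : ℝ}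
    (hf : ∀ n : ℕ, |f n| ≤ C * ((n : ℝ) ^ 2 + 1)) : Integrable f m :=
  ((hm2.add (integrable_const 1)).const_mul C).mono' (measurable_of_countable f).aestronglyMeasurable
    (Eventually.of_forall hf)

lemma integrable_natCast (hm2 : Integrable (fun n : ℕ => (n : ℝ) ^ 2) m) :
    Integrable (fun n : ℕ => (n : ℝ)) m :=
  integrable_of_sq_bound hm2 (C := 1) fun n => by
    rw [abs_of_nonneg (Nat.cast_nonneg n)]; nlinarith [sq_nonneg ((n : ℝ) - 1)]

/-- At least one of the atoms 0 and 1 differs from `ρ`. -/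
lemma integral_sub_sq_pos (hm2 : Integrable (fun n : ℕ => (n : ℝ) ^ 2) m)
    (hm0 : 0 < m.real {0}) (hm1 : 0 < m.real {1}) (ρ : ℝ) : 0 < ∫ n, ((n : ℝ) - ρ) ^ 2 ∂m := by
  have hint : Integrable (fun n : ℕ => ((n : ℝ) - ρ) ^ 2) m :=
    integrable_of_sq_bound hm2 (C := 2 + 2 * ρ ^ 2) fun n => by
      rw [abs_of_nonneg (sq_nonneg _)]
      nlinarith [sq_nonneg ((n : ℝ) + ρ), sq_nonneg ((n : ℝ) * ρ)]
  rw [integral_pos_iff_support_of_nonneg (fun n => sq_nonneg _) hint]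
  have h0 : 0 < m {0} := ((measureReal_ne_zero_iff).1 hm0.ne').bot_lt
  have h1 : 0 < m {1} := ((measureReal_ne_zero_iff).1 hm1.ne').bot_lt
  by_cases hρ : ρ = 0
  · refine h1.trans_le (measure_mono ?_)
    rintro n rfl
    simp [hρ]
  · refine h0.trans_le (measure_mono ?_)
    rintro n rfl
    simpa using hρ

/-- The limit of `√L P[S_L = N]` in the local limit theorem. -/
noncomputable def localLimitConst (m : Measure ℕ) (ρ : ℝ) : ℝ :=
  (2 * Real.pi)⁻¹ * ∫ v : ℝ, Real.exp (-((∫ n, ((n : ℝ) - ρ) ^ 2 ∂m) / 2) * v ^ 2)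

lemma localLimitConst_pos (hm2 : Integrable (fun n : ℕ => (n : ℝ) ^ 2) m)
    (hm0 : 0 < m.real {0}) (hm1 : 0 < m.real {1}) (ρ : ℝ) : 0 < localLimitConst m ρ := by
  have h := integral_sub_sq_pos hm2 hm0 hm1 ρ
  exact mul_pos (by positivity) (integral_exp_pos (integrable_exp_neg_mul_sq (by positivity)))

/-- `L (φ_L - 1)` splits into the mass defect, tending to `-τ`, a first-order term `i v` times the
quantity assumed to vanish in `hmean`, and a second-order remainder tending to `-σ² v²/2` by
dominated convergence. Then `(1 + z_L/L)^L → e^z`. -/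
lemma tendsto_centredChar_pow (hm2 : Integrable (fun n : ℕ => (n : ℝ) ^ 2) m)
    {h : ℕ → ℕ → ℝ} {a : ℕ → ℝ} {ρ τ : ℝ} (ha : Tendsto a atTop (𝓝 ρ))
    (hb : ∀ᶠ L in atTop, ∀ n, 0 ≤ h L n ∧ h L n ≤ 2)
    (hlim : ∀ n, Tendsto (fun L => h L n) atTop (𝓝 1))
    (hmass : Tendsto (fun L : ℕ => (L : ℝ) * (1 - ∫ n, h L n ∂m)) atTop (𝓝 τ))
    (hmean : Tendsto (fun L : ℕ => √(L : ℝ) * ∫ n, h L n * ((n : ℝ) - a L) ∂m) atTop (𝓝 0))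
    (v : ℝ) :
    Tendsto (fun L : ℕ => centredChar m (h L) (a L) (v / √L) ^ L) atTop
      (𝓝 ((Real.exp (-τ) *
        Real.exp (-((∫ n, ((n : ℝ) - ρ) ^ 2 ∂m) / 2) * v ^ 2) : ℝ) : ℂ)) := by
  set σ2 := ∫ n, ((n : ℝ) - ρ) ^ 2 ∂m with hσ2
  set θ : ℕ → ℕ → ℝ := fun L n => v / √L * ((n : ℝ) - a L) with hθ
  set R : ℕ → ℕ → ℂ := fun L n => (h L n : ℂ) * ((L : ℂ) *
    (Complex.exp (θ L n * Complex.I) - 1 - θ L n * Complex.I)) with hR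
  have hL0 : ∀ᶠ L : ℕ in atTop, √(L : ℝ) ≠ 0 := by
    filter_upwards [eventually_gt_atTop 0] with L hL
    exact (Real.sqrt_pos.2 (by exact_mod_cast hL)).ne'
  have habs : ∀ᶠ L in atTop, |a L| ≤ |ρ| + 1 := by
    filter_upwards [ha.abs.eventually_lt_const (lt_add_one |ρ|)] with L hL using hL.le
  have hsqb : ∀ (n : ℕ) (c : ℝ), |c| ≤ |ρ| + 1 →
      ((n : ℝ) - c) ^ 2 ≤ (2 + 2 * (|ρ| + 1) ^ 2) * ((n : ℝ) ^ 2 + 1) := by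
    intro n c hc
    have h1 : c ^ 2 ≤ (|ρ| + 1) ^ 2 := by rw [← sq_abs c]; gcongr
    nlinarith [sq_nonneg ((n : ℝ) + c), mul_nonneg (sq_nonneg (|ρ| + 1)) (sq_nonneg (n : ℝ))]
  -- the remainder integral
  have hRb : ∀ᶠ L in atTop, ∀ n, ‖R L n‖ ≤
      4 * v ^ 2 * (2 + 2 * (|ρ| + 1) ^ 2) * ((n : ℝ) ^ 2 + 1) := by
    filter_upwards [hb, hL0, habs] with L h1 h2 h3 n
    rw [hR]
    simp only
    rw [norm_mul, norm_mul, Complex.norm_natCast, Complex.norm_real,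
      Real.norm_of_nonneg (h1 n).1]
    have h4 := norm_exp_mul_I_sub_le (θ L n)
    have h5 : (L : ℝ) * θ L n ^ 2 = v ^ 2 * ((n : ℝ) - a L) ^ 2 := by
      simp only [hθ, mul_pow, div_pow, Real.sq_sqrt (Nat.cast_nonneg L)]
      have : (L : ℝ) ≠ 0 := fun h => h2 (by rw [h, Real.sqrt_zero])
      field_simp
    calc h L n * (L * ‖Complex.exp (θ L n * Complex.I) - 1 - θ L n * Complex.I‖)
        ≤ 2 * (L * (2 * θ L n ^ 2)) := by
          gcongr
          exact (h1 n).2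
      _ = 4 * v ^ 2 * ((n : ℝ) - a L) ^ 2 := by linear_combination 4 * h5
      _ ≤ 4 * v ^ 2 * ((2 + 2 * (|ρ| + 1) ^ 2) * ((n : ℝ) ^ 2 + 1)) := by
          gcongr; exact hsqb n _ h3
      _ = _ := by ring
  have hgi : Integrable (fun n : ℕ => 4 * v ^ 2 * (2 + 2 * (|ρ| + 1) ^ 2) * ((n : ℝ) ^ 2 + 1)) m :=
    (hm2.add (integrable_const 1)).const_mul _
  have hRlim : Tendsto (fun L => ∫ n, R L n ∂m) atTop
      (𝓝 (∫ n : ℕ, ((-((v * ((n : ℝ) - ρ)) ^ 2 / 2) : ℝ) : ℂ) ∂m)) := by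
    refine tendsto_integral_filter_of_dominated_convergence _
      (Eventually.of_forall fun L => (measurable_of_countable _).aestronglyMeasurable)
      (hRb.mono fun L h => Eventually.of_forall h) hgi (Eventually.of_forall fun n => ?_)
    have h1 : Tendsto (fun L : ℕ => √L * θ L n) atTop (𝓝 (v * ((n : ℝ) - ρ))) := by
      refine ((ha.const_sub (n : ℝ)).const_mul v).congr' ?_
      filter_upwards [hL0] with L hL
      simp only [hθ]
      field_simp
    have h2 := ((Complex.continuous_ofReal.tendsto _).comp (hlim n)).mul
      (tendsto_mul_exp_mul_I_sub h1)
    rw [Complex.ofReal_one, one_mul, ← Complex.ofReal_neg] at h2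
    exact h2
  have hRval : ∫ n : ℕ, ((-((v * ((n : ℝ) - ρ)) ^ 2 / 2) : ℝ) : ℂ) ∂m =
      ((-(σ2 / 2) * v ^ 2 : ℝ) : ℂ) := by
    rw [integral_complex_ofReal, hσ2]
    congr 1
    have : ∀ n : ℕ, -((v * ((n : ℝ) - ρ)) ^ 2 / 2) = (-(v ^ 2 / 2)) * ((n : ℝ) - ρ) ^ 2 :=
      fun n => by ring
    simp_rw [this]
    rw [integral_const_mul]
    ring
  rw [hRval] at hRlim
  have hA : Tendsto (fun L : ℕ => (((-((L : ℝ) * (1 - ∫ n, h L n ∂m))) : ℝ) : ℂ)) atTop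
      (𝓝 ((-τ : ℝ) : ℂ)) := (Complex.continuous_ofReal.tendsto _).comp hmass.neg
  have hB : Tendsto (fun L : ℕ => ((v * (√(L : ℝ) * ∫ n, h L n * ((n : ℝ) - a L) ∂m) : ℝ) : ℂ) *
      Complex.I) atTop (𝓝 0) := by
    have := ((Complex.continuous_ofReal.tendsto _).comp (hmean.const_mul v)).mul_const Complex.I
    simpa [Function.comp_def] using this
  have hsum := (hA.add hB).add hRlim
  rw [add_zero, ← Complex.ofReal_add] at hsum
  have hg : Tendsto (fun L : ℕ => (L : ℂ) * (centredChar m (h L) (a L) (v / √L) - 1)) atTop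
      (𝓝 ((-τ + -(σ2 / 2) * v ^ 2 : ℝ) : ℂ)) := by
    refine hsum.congr' ?_
    filter_upwards [hb, hL0, hRb] with L h1 h2 h3
    have hh : ∀ n, |h L n| ≤ 2 := fun n => by rw [abs_of_nonneg (h1 n).1]; exact (h1 n).2
    have hi1 : Integrable (fun n => h L n) m := integrable_of_abs_le hh
    have hi2 : Integrable (fun n => h L n * ((n : ℝ) - a L)) m := by
      refine Integrable.bdd_mul ((integrable_natCast hm2).sub (integrable_const _))
        (measurable_of_countable _).aestronglyMeasurable (c := 2)
        (Eventually.of_forall fun n => hh n)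
    have hi3 : Integrable (fun n => R L n) m :=
      hgi.mono' (measurable_of_countable _).aestronglyMeasurable (Eventually.of_forall h3)
    have e1 : (L : ℂ) * centredChar m (h L) (a L) (v / √L) =
        ∫ n, ((((L * h L n : ℝ) : ℂ) +
          ((v * √L * (h L n * ((n : ℝ) - a L)) : ℝ) : ℂ) * Complex.I) + R L n) ∂m := by
      rw [centredChar, ← integral_const_mul]
      refine integral_congr_ae (Eventually.of_forall fun n => ?_)
      have h5 : (L : ℝ) * θ L n = v * √L * ((n : ℝ) - a L) := by
        simp only [hθ]
        nth_rewrite 1 [← Real.mul_self_sqrt (Nat.cast_nonneg L)]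
        field_simp
      have h6 : (L : ℂ) * (θ L n : ℂ) = ((v * √L * ((n : ℝ) - a L) : ℝ) : ℂ) := by
        rw [← h5]; push_cast; rfl
      have h7 : ((v * √L * (h L n * ((n : ℝ) - a L)) : ℝ) : ℂ) =
          (h L n : ℂ) * ((L : ℂ) * (θ L n : ℂ)) := by
        rw [h6]; push_cast; ring
      simp only [hR]
      rw [h7]
      push_cast
      simp only [hθ]
      push_cast
      ring
    have hi1' : Integrable (fun n => ((L * h L n : ℝ) : ℂ)) m := (hi1.const_mul _).ofReal
    have hi2' : Integrable (fun n => ((v * √L * (h L n * ((n : ℝ) - a L)) : ℝ) : ℂ) * Complex.I) m :=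
      ((hi2.const_mul (v * √L)).ofReal (𝕜 := ℂ)).mul_const Complex.I
    have hi12 : Integrable (fun n => ((L * h L n : ℝ) : ℂ) +
        ((v * √L * (h L n * ((n : ℝ) - a L)) : ℝ) : ℂ) * Complex.I) m := hi1'.add hi2'
    rw [mul_sub (L : ℂ), e1, integral_add hi12 hi3, integral_add hi1' hi2',
      integral_complex_ofReal, integral_mul_const, integral_complex_ofReal, integral_const_mul,
      integral_const_mul]
    push_cast
    ring
  have hfin := Complex.tendsto_one_add_pow_exp_of_tendsto hg
  rw [← Real.exp_add, Complex.ofReal_exp]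
  exact hfin.congr fun L => by rw [add_sub_cancel]

/-- Local limit theorem for triangular arrays of sub-probability densities `h_L` with respect to
`m`. -/
theorem tendsto_sqrt_mul_totalMass (hm2 : Integrable (fun n : ℕ => (n : ℝ) ^ 2) m)
    (hm0 : 0 < m.real {0}) (hm1 : 0 < m.real {1})
    {h : ℕ → ℕ → ℝ} {N : ℕ → ℕ} {ρ τ : ℝ}
    (hN : Tendsto (fun L : ℕ => (N L : ℝ) / L) atTop (𝓝 ρ))
    (hb : ∀ᶠ L in atTop, ∀ n, 0 ≤ h L n ∧ h L n ≤ 2)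
    (hint : ∀ᶠ L in atTop, ∫ n, h L n ∂m ≤ 1)
    (hlim : ∀ n, Tendsto (fun L => h L n) atTop (𝓝 1))
    (hmass : Tendsto (fun L : ℕ => (L : ℝ) * (1 - ∫ n, h L n ∂m)) atTop (𝓝 τ))
    (hmean : Tendsto (fun L : ℕ => √(L : ℝ) * ∫ n, h L n * ((n : ℝ) - N L / L) ∂m) atTop (𝓝 0)) :
    Tendsto (fun L : ℕ => √(L : ℝ) * totalMass m (h L) L (N L)) atTop
      (𝓝 (localLimitConst m ρ * Real.exp (-τ))) := by
  set σ2 := ∫ n, ((n : ℝ) - ρ) ^ 2 ∂m with hσ2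
  set δ := min (m.real {0}) (m.real {1}) with hδ
  have hδ0 : 0 < δ := lt_min hm0 hm1
  have hpi := Real.pi_pos
  set c := δ / (2 * Real.pi ^ 2) with hc
  have hc0 : 0 < c := by positivity
  have hconv : Tendsto (fun L : ℕ => ∫ v : ℝ,
      (Set.Ioc (-(√L * Real.pi)) (√L * Real.pi)).indicator
        (fun v => centredChar m (h L) (N L / L) (v / √L) ^ L) v) atTop
      (𝓝 (∫ v : ℝ, ((Real.exp (-τ) * Real.exp (-(σ2 / 2) * v ^ 2) : ℝ) : ℂ))) := by
    -- The bound `exp(-c (v/√L)²)` on one factor, raised to the power `L`, becomes a Gaussian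
    -- independent of `L`.
    refine tendsto_integral_filter_of_dominated_convergence (fun v => Real.exp (-c * v ^ 2))
      ?_ ?_ (integrable_exp_neg_mul_sq hc0) (Eventually.of_forall fun v => ?_)
    · filter_upwards [hb] with L h1
      have hh : ∀ n, |h L n| ≤ 2 := fun n => by rw [abs_of_nonneg (h1 n).1]; exact (h1 n).2
      refine AEStronglyMeasurable.indicator ?_ measurableSet_Ioc
      exact (((continuous_centredChar hh _).comp
        (continuous_id.div_const _)).pow L).aestronglyMeasurable
    · filter_upwards [hb, hint, (hlim 0).eventually_const_le (by norm_num : (1 / 2 : ℝ) < 1),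
        (hlim 1).eventually_const_le (by norm_num : (1 / 2 : ℝ) < 1), eventually_gt_atTop 0]
        with L h1 h2 h3 h4 h5
      have hh : ∀ n, |h L n| ≤ 2 := fun n => by rw [abs_of_nonneg (h1 n).1]; exact (h1 n).2
      refine Eventually.of_forall fun v => ?_
      by_cases hv : v ∈ Set.Ioc (-(√L * Real.pi)) (√L * Real.pi)
      · have hs : 0 < √(L : ℝ) := Real.sqrt_pos.2 (by exact_mod_cast h5)
        have hvs : |v / √L| ≤ Real.pi := by
          rw [abs_div, abs_of_pos hs, div_le_iff₀ hs, mul_comm, abs_le]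
          exact ⟨hv.1.le, hv.2⟩
        rw [Set.indicator_of_mem hv, norm_pow]
        calc _ ≤ Real.exp (-c * (v / √L) ^ 2) ^ L :=
              pow_le_pow_left₀ (norm_nonneg _) (norm_centredChar_le hh (fun n => (h1 n).1) h3 h4 h2
                hδ0.le (min_le_left _ _) (min_le_right _ _) _ hvs) L
          _ = Real.exp (-c * v ^ 2) := by
              rw [← Real.exp_nat_mul, div_pow, Real.sq_sqrt (Nat.cast_nonneg L)]
              have : (L : ℝ) ≠ 0 := by exact_mod_cast h5.ne'
              congr 1; field_simp
      · rw [Set.indicator_of_notMem hv, norm_zero]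
        exact (Real.exp_pos _).le
    · have hsq : Tendsto (fun L : ℕ => √(L : ℝ) * Real.pi) atTop atTop :=
        (Real.tendsto_sqrt_atTop.comp tendsto_natCast_atTop_atTop).atTop_mul_const hpi
      refine (tendsto_centredChar_pow hm2 hN hb hlim hmass hmean v).congr' ?_
      filter_upwards [hsq.eventually_gt_atTop |v|] with L hL
      rw [Set.indicator_of_mem]
      exact ⟨(abs_lt.1 hL).1, (abs_lt.1 hL).2.le⟩
  rw [integral_complex_ofReal, integral_const_mul] at hconv
  have h1 : Tendsto (fun L : ℕ => ((2 * Real.pi * (√L * totalMass m (h L) L (N L)) : ℝ) : ℂ)) atTop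
      (𝓝 ((Real.exp (-τ) * ∫ v : ℝ, Real.exp (-(σ2 / 2) * v ^ 2) : ℝ) : ℂ)) := by
    refine hconv.congr' ?_
    filter_upwards [hb, eventually_gt_atTop 0] with L h1 h2
    exact (sqrt_mul_totalMass (fun n => by rw [abs_of_nonneg (h1 n).1]; exact (h1 n).2) h2).symm
  have h2 := ((Complex.continuous_re.tendsto _).comp h1).const_mul (2 * Real.pi)⁻¹
  simp only [Function.comp_def, Complex.ofReal_re] at h2
  have h3 : localLimitConst m ρ * Real.exp (-τ) =
      (2 * Real.pi)⁻¹ * (Real.exp (-τ) * ∫ v : ℝ, Real.exp (-(σ2 / 2) * v ^ 2)) := by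
    rw [localLimitConst]; ring
  rw [h3]
  refine h2.congr fun L => ?_
  field_simp

end LocalLimit

/-! ### The one-site law at criticality. -/

section Site

variable {g : ℕ → ℝ} {lam b A : ℝ}

lemma weight_pos (hg : IsStretchedExp g lam b A) (n : ℕ) : 0 < weight g n := by
  refine Finset.prod_pos fun k hk => one_div_pos.2 ?_
  have hk0 : k ≠ 0 := by have := (Finset.mem_Icc.1 hk).1; omega
  exact lt_of_le_of_ne (hg.rate_nonneg k) fun h => hk0 ((hg.rate_eq_zero_iff k).1 h.symm)

/-- A stretched exponential decays faster than `n^{-(p+2)}`. Below, the second moment gives the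
variance and the fourth controls truncation errors. -/
lemma summable_weight_mul_pow (hg : IsStretchedExp g lam b A) (p : ℕ) :
    Summable fun n : ℕ => weight g n * (n : ℝ) ^ p := by
  have h1l : 0 < 1 - lam := by linarith [hg.lam_lt_one]
  have hc : 0 < b / (1 - lam) := div_pos hg.b_pos h1l
  have hpow : Tendsto (fun n : ℕ => (n : ℝ) ^ (1 - lam)) atTop atTop :=
    (tendsto_rpow_atTop h1l).comp tendsto_natCast_atTop_atTop
  have h1 := (isLittleO_exp_neg_mul_rpow_atTop hc (-((p + 2 : ℕ) / (1 - lam)))).comp_tendsto hpow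
  have h2 : (fun n : ℕ => weight g n) =O[atTop] fun n : ℕ => ((n : ℝ) ^ (p + 2))⁻¹ := by
    refine (hg.weight_equiv.isBigO.trans ?_)
    refine IsBigO.const_mul_left ?_ A
    refine (h1.isBigO.congr' (Eventually.of_forall fun n => rfl) ?_)
    filter_upwards with n
    simp only [Function.comp]
    rw [← Real.rpow_mul (Nat.cast_nonneg n), mul_neg, mul_div_cancel₀ _ h1l.ne',
      Real.rpow_neg (Nat.cast_nonneg n), Real.rpow_natCast]
  refine summable_of_isBigO_nat (Real.summable_nat_pow_inv.2 (one_lt_two)) ?_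
  refine (h2.mul (isBigO_refl (fun n : ℕ => (n : ℝ) ^ p) atTop)).congr' EventuallyEq.rfl ?_
  filter_upwards [eventually_gt_atTop 0] with n hn
  have : (n : ℝ) ≠ 0 := by exact_mod_cast hn.ne'
  field_simp
  ring

lemma partitionFn_one : partitionFn g 1 = ∑' n, weight g n := by simp [partitionFn]

lemma summable_weight (hg : IsStretchedExp g lam b A) : Summable (weight g) := by
  simpa using summable_weight_mul_pow hg 0

lemma partitionFn_pos (hg : IsStretchedExp g lam b A) : 0 < partitionFn g 1 := by
  rw [partitionFn_one]
  exact (summable_weight hg).tsum_pos (fun n => (weight_pos hg n).le) 0 (weight_pos hg 0)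

lemma siteMeasure_one : siteMeasure g 1 = Measure.sum fun n : ℕ =>
    ENNReal.ofReal (weight g n / partitionFn g 1) • Measure.dirac n := by
  simp [siteMeasure]

lemma isProbabilityMeasure_siteMeasure (hg : IsStretchedExp g lam b A) :
    IsProbabilityMeasure (siteMeasure g 1) := by
  constructor
  rw [siteMeasure_one, Measure.sum_apply _ MeasurableSet.univ]
  simp only [Measure.smul_apply, measure_univ, smul_eq_mul, mul_one]
  rw [← ENNReal.ofReal_tsum_of_nonneg (fun n => div_nonneg (weight_pos hg n).le
    (partitionFn_pos hg).le) ((summable_weight hg).div_const _), tsum_div_const, ← partitionFn_one,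
    div_self (partitionFn_pos hg).ne', ENNReal.ofReal_one]

lemma toReal_site_coeff (hg : IsStretchedExp g lam b A) (n : ℕ) :
    (ENNReal.ofReal (weight g n / partitionFn g 1)).toReal = weight g n / partitionFn g 1 :=
  ENNReal.toReal_ofReal (div_nonneg (weight_pos hg n).le (partitionFn_pos hg).le)

lemma integrable_pow_siteMeasure (hg : IsStretchedExp g lam b A) (p : ℕ) :
    Integrable (fun n : ℕ => (n : ℝ) ^ p) (siteMeasure g 1) := by
  rw [siteMeasure_one]
  refine integrable_sum_dirac (fun n => ENNReal.ofReal_ne_top) ?_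
  simp_rw [toReal_site_coeff hg]
  refine ((summable_weight_mul_pow hg p).div_const (partitionFn g 1)).congr fun n => ?_
  rw [Real.norm_of_nonneg (by positivity)]
  ring

lemma siteMeasure_real_singleton (hg : IsStretchedExp g lam b A) (k : ℕ) :
    (siteMeasure g 1).real {k} = weight g k / partitionFn g 1 := by
  rw [measureReal_def, siteMeasure_one, Measure.sum_apply _ (measurableSet_singleton k),
    tsum_eq_single k]
  · simp [toReal_site_coeff hg]
  · intro n hn
    simp [hn]

lemma integral_tail_siteMeasure (hg : IsStretchedExp g lam b A) {s u : ℝ} (hs : 0 ≤ s)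
    (hu : 0 ≤ u) :
    ∫ n, {n : ℕ | (n : ℝ) ≤ u}ᶜ.indicator (fun n : ℕ => Real.exp (-s * n)) n ∂siteMeasure g 1 =
      tailSum (weight g) s ⌊u⌋₊ / partitionFn g 1 := by
  have hsum : Summable fun n : ℕ => (weight g n / partitionFn g 1) *
      {n : ℕ | (n : ℝ) ≤ u}ᶜ.indicator (fun n : ℕ => Real.exp (-s * n)) n := by
    refine Summable.of_nonneg_of_le (fun n => ?_) (fun n => ?_)
      ((summable_weight hg).div_const (partitionFn g 1))
    · exact mul_nonneg (div_nonneg (weight_pos hg n).le (partitionFn_pos hg).le)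
        (Set.indicator_nonneg (fun n _ => (Real.exp_pos _).le) n)
    · refine mul_le_of_le_one_right (div_nonneg (weight_pos hg n).le (partitionFn_pos hg).le) ?_
      refine Set.indicator_le' (fun n _ => ?_) (fun _ _ => zero_le_one) n
      rw [Real.exp_le_one_iff]
      have : 0 ≤ s * n := by positivity
      linarith
  have h1 : ∫ n, {n : ℕ | (n : ℝ) ≤ u}ᶜ.indicator (fun n : ℕ => Real.exp (-s * n)) n
      ∂siteMeasure g 1 = ∑' n : ℕ, (weight g n / partitionFn g 1) *
      {n : ℕ | (n : ℝ) ≤ u}ᶜ.indicator (fun n : ℕ => Real.exp (-s * n)) n := by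
    rw [siteMeasure_one, integral_sum_dirac (fun n => ENNReal.ofReal_ne_top)]
    simp_rw [toReal_site_coeff hg, smul_eq_mul]
  rw [h1, ← hsum.sum_add_tsum_nat_add (⌊u⌋₊ + 1), Finset.sum_eq_zero, zero_add, tailSum,
    ← tsum_div_const]
  · refine tsum_congr fun k => ?_
    have hk : k + (⌊u⌋₊ + 1) = ⌊u⌋₊ + k + 1 := by omega
    rw [hk, Set.indicator_of_mem]
    · ring
    · simp only [Set.mem_compl_iff, Set.mem_ofPred_eq, not_le]
      calc u < ⌊u⌋₊ + 1 := Nat.lt_floor_add_one u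
        _ ≤ ((⌊u⌋₊ + k + 1 : ℕ) : ℝ) := by push_cast; linarith [(Nat.cast_nonneg k : (0 : ℝ) ≤ k)]
  · intro n hn
    rw [Set.indicator_of_notMem, mul_zero]
    simp only [Set.mem_compl_iff, Set.mem_ofPred_eq, not_not]
    exact (Nat.le_floor_iff hu).1 (by have := Finset.mem_range.1 hn; omega)

end Site

/-! ### Tilt invariance and the maximum as a product event. -/

section Occupation

/-- Tilting by `e^{-s n} / Z` changes the mass of `{S_L = N}` by a factor independent of `E`. -/
lemma totalMass_tilt (m : Measure ℕ) (E : Set ℕ) (s Z : ℝ) (L N : ℕ) :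
    totalMass m (E.indicator fun n : ℕ => Real.exp (-s * n) / Z) L N =
      Real.exp (-s * N) / Z ^ L * totalMass m (E.indicator fun _ => 1) L N := by
  rw [totalMass, totalMass, ← integral_const_mul]
  refine integral_congr_ae (Eventually.of_forall fun η => ?_)
  simp only
  by_cases h : total η = N
  · rw [Set.indicator_of_mem (show η ∈ {η | total η = N} from h),
      Set.indicator_of_mem (show η ∈ {η | total η = N} from h)]
    have h1 : ∀ n : ℕ, E.indicator (fun n : ℕ => Real.exp (-s * n) / Z) n =
        Real.exp (-s * n) / Z * E.indicator (fun _ => (1 : ℝ)) n := fun n => by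
      by_cases hn : n ∈ E <;> simp [hn]
    simp_rw [h1]
    rw [Finset.prod_mul_distrib, Finset.prod_div_distrib, ← Real.exp_sum, ← Finset.mul_sum,
      ← Nat.cast_sum]
    have h2 : ∑ i, η i = N := h
    simp [h2]
  · rw [Set.indicator_of_notMem (show η ∉ {η | total η = N} from h),
      Set.indicator_of_notMem (show η ∉ {η | total η = N} from h), mul_zero]

lemma setOf_maxOcc_le {L : ℕ} (hL : 0 < L) (u : ℝ) :
    {η : Fin L → ℕ | (maxOcc η : ℝ) ≤ u} = {η | ∀ i, η i ∈ {n : ℕ | (n : ℝ) ≤ u}} := by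
  ext η
  simp only [Set.mem_ofPred_eq, maxOcc]
  constructor
  · intro h i
    exact le_trans (by exact_mod_cast Finset.le_sup (f := η) (Finset.mem_univ i)) h
  · intro h
    have : (Finset.univ : Finset (Fin L)).Nonempty := ⟨⟨0, hL⟩, Finset.mem_univ _⟩
    obtain ⟨i, -, hi⟩ := Finset.exists_mem_eq_sup Finset.univ this η
    rw [hi]; exact h i

lemma pi_real_setOf_forall_mem {m : Measure ℕ} [IsProbabilityMeasure m] (L : ℕ) (E : Set ℕ) :
    (Measure.pi fun _ : Fin L => m).real {η | ∀ i, η i ∈ E} = (1 - m.real Eᶜ) ^ L := by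
  have h1 : {η : Fin L → ℕ | ∀ i, η i ∈ E} = Set.univ.pi fun _ => E := by ext; simp
  rw [h1, measureReal_def, Measure.pi_pi, Finset.prod_const, Finset.card_univ, Fintype.card_fin,
    ENNReal.toReal_pow, ← measureReal_def, probReal_compl_eq_one_sub (MeasurableSet.of_discrete)]
  ring

lemma totalMass_indicator_one (m : Measure ℕ) (E : Set ℕ) (L N : ℕ) :
    totalMass m (E.indicator fun _ => 1) L N =
      (Measure.pi fun _ : Fin L => m).real ({η | total η = N} ∩ {η | ∀ i, η i ∈ E}) := by
  rw [totalMass, ← integral_indicator_one (Set.to_countable _).measurableSet]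
  refine integral_congr_ae (Eventually.of_forall fun η => ?_)
  by_cases h : total η = N
  · rw [Set.indicator_of_mem (show η ∈ {η | total η = N} from h)]
    by_cases h2 : ∀ i, η i ∈ E
    · rw [Set.indicator_of_mem (show η ∈ {η | total η = N} ∩ {η | ∀ i, η i ∈ E} from ⟨h, h2⟩)]
      simp [h2]
    · rw [Set.indicator_of_notMem fun hm => h2 hm.2]
      push Not at h2
      obtain ⟨i, hi⟩ := h2
      exact Finset.prod_eq_zero (Finset.mem_univ i) (Set.indicator_of_notMem hi _)
  · rw [Set.indicator_of_notMem (show η ∉ {η | total η = N} from h),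
      Set.indicator_of_notMem fun hm => h hm.1]

end Occupation

/-! ### Choice of the tilt and the conditional limit. -/

section Fugacity

variable {m : Measure ℕ}

lemma exp_neg_mul_le_one {s : ℝ} (hs : 0 ≤ s) (n : ℕ) : Real.exp (-s * n) ≤ 1 := by
  rw [Real.exp_le_one_iff]
  have : 0 ≤ s * n := by positivity
  linarith

lemma integrable_exp_neg_mul [IsProbabilityMeasure m] {s : ℝ} (hs : 0 ≤ s) :
    Integrable (fun n : ℕ => Real.exp (-s * n)) m :=
  integrable_of_abs_le fun n => by
    rw [abs_of_pos (Real.exp_pos _)]; exact exp_neg_mul_le_one hs n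

lemma integrable_mul_exp_neg_mul {f : ℕ → ℝ} (hf : Integrable f m) {s : ℝ} (hs : 0 ≤ s) :
    Integrable (fun n : ℕ => f n * Real.exp (-s * n)) m :=
  hf.mul_bdd (c := 1) (measurable_of_countable _).aestronglyMeasurable (Eventually.of_forall fun n => by
    rw [Real.norm_of_nonneg (Real.exp_pos _).le]; exact exp_neg_mul_le_one hs n)

lemma continuousOn_integral_mul_exp {f : ℕ → ℝ} (hf : Integrable f m) :
    ContinuousOn (fun s : ℝ => ∫ n, f n * Real.exp (-s * n) ∂m) (Set.Ici 0) := by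
  refine continuousOn_of_dominated (bound := fun n => |f n|)
    (fun s hs => (measurable_of_countable _).aestronglyMeasurable)
    (fun s hs => Eventually.of_forall fun n => ?_) hf.abs
    (Eventually.of_forall fun n => by fun_prop)
  rw [norm_mul, Real.norm_of_nonneg (Real.exp_pos _).le]
  exact mul_le_of_le_one_right (abs_nonneg _) (exp_neg_mul_le_one hs n)

/-- The normalisation `∫ e^{-s n} dm`. -/
noncomputable def tiltNorm (m : Measure ℕ) (s : ℝ) : ℝ := ∫ n, Real.exp (-s * n) ∂m

lemma tiltNorm_pos [IsProbabilityMeasure m] {s : ℝ} (hs : 0 ≤ s) : 0 < tiltNorm m s :=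
  integral_exp_pos (integrable_exp_neg_mul hs)

lemma continuousOn_tiltNorm [IsProbabilityMeasure m] : ContinuousOn (tiltNorm m) (Set.Ici 0) := by
  have := continuousOn_integral_mul_exp (m := m) (f := fun _ => 1) (integrable_const _)
  simp only [one_mul] at this
  exact this

lemma tendsto_tiltNorm [IsProbabilityMeasure m] {ι : Type*} {l : Filter ι} {s : ι → ℝ} (hs : ∀ᶠ i in l, 0 ≤ s i)
    (hs0 : Tendsto s l (𝓝 0)) : Tendsto (fun i => tiltNorm m (s i)) l (𝓝 1) := by
  have h1 : Tendsto (tiltNorm m) (𝓝[Set.Ici 0] 0) (𝓝 (tiltNorm m 0)) :=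
    continuousOn_tiltNorm 0 (by simp)
  have h2 : tiltNorm m 0 = 1 := by simp [tiltNorm]
  rw [h2] at h1
  exact h1.comp (tendsto_nhdsWithin_iff.2 ⟨hs0, hs⟩)

/-- Deficit of the mean of the tilted law below `ρ`. -/
noncomputable def tiltDeficit (m : Measure ℕ) (ρ s : ℝ) : ℝ :=
  (∫ n, (ρ - (n : ℝ)) * Real.exp (-s * n) ∂m) / tiltNorm m s

lemma continuousOn_tiltDeficit [IsProbabilityMeasure m] (hm2 : Integrable (fun n : ℕ => (n : ℝ) ^ 2) m) (ρ : ℝ) :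
    ContinuousOn (tiltDeficit m ρ) (Set.Ici 0) :=
  (continuousOn_integral_mul_exp ((integrable_const ρ).sub (integrable_natCast hm2))).div
    continuousOn_tiltNorm fun _ hs => (tiltNorm_pos hs).ne'

/-- The mean of the tilted law has right derivative minus the variance at `s = 0`. Only `s > 0` is
considered, where the factor `e^{-s n}` is bounded. -/
lemma tendsto_tiltDeficit_div [IsProbabilityMeasure m] (hm2 : Integrable (fun n : ℕ => (n : ℝ) ^ 2) m) {ρ : ℝ}
    (hρ : ∫ n, (n : ℝ) ∂m = ρ) :
    Tendsto (fun s => tiltDeficit m ρ s / s) (𝓝[>] 0) (𝓝 (∫ n, ((n : ℝ) - ρ) ^ 2 ∂m)) := by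
  have hn := integrable_natCast hm2
  have hpos : ∀ᶠ s : ℝ in 𝓝[>] 0, 0 < s := eventually_mem_nhdsWithin
  have h1 : Tendsto (fun s : ℝ => ∫ n : ℕ, ((n : ℝ) - ρ) * ((1 - Real.exp (-s * n)) / s) ∂m) (𝓝[>] 0)
      (𝓝 (∫ n : ℕ, ((n : ℝ) - ρ) * n ∂m)) := by
    refine tendsto_integral_filter_of_dominated_convergence (fun n : ℕ => |((n : ℝ) - ρ) * n|)
      (Eventually.of_forall fun s => (measurable_of_countable _).aestronglyMeasurable) ?_ ?_
      (Eventually.of_forall fun n => ?_)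
    · filter_upwards [hpos] with s hs
      refine Eventually.of_forall fun n => ?_
      rw [norm_mul, abs_mul]
      refine mul_le_mul_of_nonneg_left ?_ (abs_nonneg _)
      have h2 := exp_neg_mul_le_one hs.le n
      have h3 := Real.add_one_le_exp (-s * n)
      rw [Real.norm_of_nonneg (div_nonneg (by linarith) hs.le), abs_of_nonneg (Nat.cast_nonneg n),
        div_le_iff₀ hs]
      linarith
    · refine (integrable_of_sq_bound hm2 (C := 1 + |ρ|) fun n => ?_).abs
      have hn0 : (0 : ℝ) ≤ n := Nat.cast_nonneg n
      have h2 : |(n : ℝ) - ρ| ≤ n + |ρ| := by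
        have := abs_sub (n : ℝ) ρ
        rwa [abs_of_nonneg hn0] at this
      rw [abs_mul, abs_of_nonneg hn0]
      nlinarith [abs_nonneg ρ, mul_le_mul_of_nonneg_right h2 hn0,
        mul_nonneg (abs_nonneg ρ) (sq_nonneg ((n : ℝ) - 1))]
    · refine Tendsto.const_mul _ ?_
      have hd : HasDerivAt (fun s : ℝ => 1 - Real.exp (-s * n)) (n : ℝ) 0 := by
        have := (((hasDerivAt_id (0 : ℝ)).neg.mul_const (n : ℝ)).exp).const_sub 1
        simpa using this
      have := hd.tendsto_slope_zero_right
      refine this.congr fun s => ?_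
      simp [div_eq_inv_mul]
  have hcov : ∫ n : ℕ, ((n : ℝ) - ρ) * n ∂m = ∫ n, ((n : ℝ) - ρ) ^ 2 ∂m := by
    have hc : ∫ n : ℕ, ((n : ℝ) - ρ) ∂m = 0 := by
      rw [integral_sub hn (integrable_const _), hρ]; simp
    have e : ∀ n : ℕ, ((n : ℝ) - ρ) * n = ((n : ℝ) - ρ) ^ 2 + ρ * ((n : ℝ) - ρ) := fun n => by ring
    simp_rw [e]
    have hi1 : Integrable (fun n : ℕ => ((n : ℝ) - ρ) ^ 2) m :=
      integrable_of_sq_bound hm2 (C := 2 + 2 * ρ ^ 2) fun n => by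
        rw [abs_of_nonneg (sq_nonneg _)]
        nlinarith [sq_nonneg ((n : ℝ) + ρ), sq_nonneg ((n : ℝ) * ρ)]
    have hi2 : Integrable (fun n : ℕ => ρ * ((n : ℝ) - ρ)) m :=
      (hn.sub (integrable_const _)).const_mul _
    rw [integral_add hi1 hi2, integral_const_mul, hc, mul_zero, add_zero]
  rw [hcov] at h1
  have h2 : Tendsto (fun s : ℝ => tiltNorm m s) (𝓝[>] 0) (𝓝 1) :=
    tendsto_tiltNorm (hpos.mono fun s hs => hs.le) (tendsto_id.mono_left nhdsWithin_le_nhds)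
  have h3 := h1.div h2 one_ne_zero
  rw [div_one] at h3
  refine h3.congr' ?_
  filter_upwards [hpos] with s hs
  -- The integral of `(n - ρ)/s` vanishes; subtracting it produces the difference quotient,
  -- dominated by `|(n - ρ) n|`.
  have e : ∫ n : ℕ, ((n : ℝ) - ρ) * ((1 - Real.exp (-s * n)) / s) ∂m =
      (∫ n, (ρ - (n : ℝ)) * Real.exp (-s * n) ∂m) / s := by
    have hc : ∫ n : ℕ, ((n : ℝ) - ρ) / s ∂m = 0 := by
      rw [integral_div, integral_sub hn (integrable_const _), hρ]; simp
    have hi1 : Integrable (fun n : ℕ => ((n : ℝ) - ρ) / s) m :=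
      (hn.sub (integrable_const _)).div_const s
    have hi2 : Integrable (fun n : ℕ => (ρ - (n : ℝ)) * Real.exp (-s * n)) m :=
      integrable_mul_exp_neg_mul ((integrable_const ρ).sub hn) hs.le
    rw [← integral_div, ← zero_add (∫ n : ℕ, (ρ - (n : ℝ)) * Real.exp (-s * n) / s ∂m), ← hc,
      ← integral_add hi1 (hi2.div_const s)]
    refine integral_congr_ae (Eventually.of_forall fun n => ?_)
    simp only
    ring
  simp only [Pi.div_apply, tiltDeficit]
  rw [e, div_right_comm]

/-- A tilt realising densities `a_L ↑ ρ` from below, and its asymptotic size. -/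
lemma exists_tilt [IsProbabilityMeasure m] (hm2 : Integrable (fun n : ℕ => (n : ℝ) ^ 2) m) (hm0 : 0 < m.real {0})
    (hm1 : 0 < m.real {1}) {ρ : ℝ} (hρ : ∫ n, (n : ℝ) ∂m = ρ) {a : ℕ → ℝ}
    (ha : Tendsto a atTop (𝓝 ρ)) (haρ : ∀ᶠ L in atTop, a L ≤ ρ) :
    ∃ s k : ℕ → ℝ, (∀ᶠ L in atTop, 0 ≤ s L) ∧ Tendsto s atTop (𝓝 0) ∧
      Tendsto k atTop (𝓝 (∫ n, ((n : ℝ) - ρ) ^ 2 ∂m)) ∧ (∀ᶠ L in atTop, s L * k L = ρ - a L) ∧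
      ∀ᶠ L in atTop, ∫ n, ((n : ℝ) - a L) * Real.exp (-s L * n) ∂m = 0 := by
  set σ2 := ∫ n, ((n : ℝ) - ρ) ^ 2 ∂m with hσ2
  have hσ : 0 < σ2 := integral_sub_sq_pos hm2 hm0 hm1 ρ
  have hn := integrable_natCast hm2
  set D := tiltDeficit m ρ with hD
  have hD0 : D 0 = 0 := by
    have : ∫ n : ℕ, (ρ - (n : ℝ)) ∂m = 0 := by
      rw [integral_sub (integrable_const _) hn, hρ]; simp
    simp [hD, tiltDeficit, this]
  have hlim := tendsto_tiltDeficit_div hm2 hρ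
  -- This linear lower bound makes all small deficits attainable on `[0, δ]` and later forces the
  -- chosen `s_L` to 0.
  obtain ⟨δ, hδ0, hδ⟩ : ∃ δ > 0, ∀ s ∈ Set.Ioc 0 δ, σ2 / 2 * s ≤ D s := by
    have h1 := hlim.eventually_const_le (half_lt_self hσ)
    obtain ⟨δ, hδ, h⟩ := mem_nhdsGT_iff_exists_Ioc_subset.1 h1
    exact ⟨δ, hδ, fun s hs => (le_div_iff₀ hs.1).1 (h hs)⟩
  have hδ' : ∀ s ∈ Set.Icc 0 δ, σ2 / 2 * s ≤ D s := fun s hs => by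
    rcases hs.1.eq_or_lt with h | h
    · rw [← h, hD0, mul_zero]
    · exact hδ s ⟨h, hs.2⟩
  have hDδ : 0 < D δ := lt_of_lt_of_le (by positivity) (hδ δ ⟨hδ0, le_rfl⟩)
  have hdef : Tendsto (fun L => ρ - a L) atTop (𝓝 0) := by simpa using ha.const_sub ρ
  have hex : ∀ᶠ L in atTop, ∃ s ∈ Set.Icc 0 δ, D s = ρ - a L := by
    filter_upwards [haρ, hdef.eventually_le_const hDδ] with L h1 h2
    have hc : ContinuousOn D (Set.Icc 0 δ) :=
      (continuousOn_tiltDeficit hm2 ρ).mono fun x hx => hx.1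
    obtain ⟨s, hs, h⟩ := intermediate_value_Icc hδ0.le hc
      (show ρ - a L ∈ Set.Icc (D 0) (D δ) from ⟨by rw [hD0]; linarith, h2⟩)
    exact ⟨s, hs, h⟩
  obtain ⟨s, hs⟩ := hex.choice
  have hs0 : ∀ᶠ L in atTop, 0 ≤ s L := hs.mono fun L h => h.1.1
  have hsl : Tendsto s atTop (𝓝 0) := by
    have h1 : Tendsto (fun L => 2 / σ2 * (ρ - a L)) atTop (𝓝 0) := by
      simpa using hdef.const_mul (2 / σ2)
    refine squeeze_zero' hs0 ?_ h1
    filter_upwards [hs] with L h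
    have := hδ' _ h.1
    rw [h.2] at this
    rw [div_mul_eq_mul_div, le_div_iff₀ hσ]
    linarith
  -- `k` is the deficit divided by `s`, extended by its limit `σ2` at `s = 0`, so that `s k = ρ - a`
  -- also holds when `a_L = ρ`.
  refine ⟨s, fun L => if s L = 0 then σ2 else D (s L) / s L, hs0, hsl, ?_, ?_, ?_⟩
  · have hk : Tendsto (fun x : ℝ => if x = 0 then σ2 else D x / x) (𝓝[≥] 0) (𝓝 σ2) := by
      rw [← Set.Ioi_insert, nhdsWithin_insert, tendsto_sup]
      constructor
      · refine (tendsto_const_nhds (x := σ2)).congr' ?_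
        simp [EventuallyEq]
      · refine hlim.congr' ?_
        filter_upwards [self_mem_nhdsWithin] with x hx
        rw [if_neg (ne_of_gt hx)]
    exact hk.comp (tendsto_nhdsWithin_iff.2 ⟨hsl, hs0⟩)
  · filter_upwards [hs] with L h
    by_cases h0 : s L = 0
    · have := h.2
      rw [h0, hD0] at this
      rw [h0, zero_mul, this]
    · rw [if_neg h0, mul_div_cancel₀ _ h0, h.2]
  · filter_upwards [hs] with L h
    have h1 := h.2
    rw [hD, tiltDeficit, div_eq_iff (tiltNorm_pos h.1.1).ne', tiltNorm] at h1
    have e : ∀ n : ℕ, ((n : ℝ) - a L) * Real.exp (-s L * n) =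
        (ρ - a L) * Real.exp (-s L * n) - (ρ - (n : ℝ)) * Real.exp (-s L * n) := fun n => by ring
    simp_rw [e]
    have hi : Integrable (fun n : ℕ => (ρ - (n : ℝ)) * Real.exp (-s L * n)) m :=
      integrable_mul_exp_neg_mul ((integrable_const ρ).sub hn) h.1.1
    rw [integral_sub ((integrable_exp_neg_mul h.1.1).const_mul _) hi, integral_const_mul, h1]
    ring

/-- Local limit theorem for the tilted law restricted to sets `E_L` of mass `1 - τ / L`. -/
lemma tendsto_sqrt_mul_totalMass_tilt [IsProbabilityMeasure m] (hm4 : Integrable (fun n : ℕ => (n : ℝ) ^ 4) m)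
    (hm2 : Integrable (fun n : ℕ => (n : ℝ) ^ 2) m)
    (hm0 : 0 < m.real {0}) (hm1 : 0 < m.real {1}) {N : ℕ → ℕ} {ρ τ : ℝ} {s : ℕ → ℝ}
    {E : ℕ → Set ℕ}
    (hN : Tendsto (fun L : ℕ => (N L : ℝ) / L) atTop (𝓝 ρ)) (hs : ∀ᶠ L in atTop, 0 ≤ s L)
    (hs0 : Tendsto s atTop (𝓝 0))
    (hmean : ∀ᶠ L : ℕ in atTop, ∫ n, ((n : ℝ) - N L / L) * Real.exp (-s L * n) ∂m = 0)
    (hE : ∀ n, ∀ᶠ L in atTop, n ∈ E L)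
    (htail : Tendsto (fun L : ℕ => (L : ℝ) * ∫ n, (E L)ᶜ.indicator
      (fun n : ℕ => Real.exp (-s L * n)) n ∂m) atTop (𝓝 τ)) :
    Tendsto (fun L : ℕ => √(L : ℝ) * totalMass m
      ((E L).indicator fun n : ℕ => Real.exp (-s L * n) / tiltNorm m (s L)) L (N L)) atTop
      (𝓝 (localLimitConst m ρ * Real.exp (-τ))) := by
  have hZ := tendsto_tiltNorm (m := m) hs hs0
  set Z : ℕ → ℝ := fun L => tiltNorm m (s L) with hZdef
  set T : ℕ → ℝ := fun L => ∫ n, (E L)ᶜ.indicator (fun n : ℕ => Real.exp (-s L * n)) n ∂m with hT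
  have hZh : ∀ᶠ L in atTop, 1 / 2 ≤ Z L := hZ.eventually_const_le (by norm_num)
  have hcompl : ∀ᶠ L in atTop, ∫ n, (E L).indicator
      (fun n : ℕ => Real.exp (-s L * n) / Z L) n ∂m = 1 - T L / Z L := by
    filter_upwards [hs, hZh] with L h1 h2
    have hi : Integrable (fun n : ℕ => Real.exp (-s L * n)) m := integrable_exp_neg_mul h1
    have h3 := integral_add_compl (MeasurableSet.of_discrete (s := E L)) hi
    rw [← integral_indicator MeasurableSet.of_discrete,
      ← integral_indicator MeasurableSet.of_discrete] at h3
    have h4 : ∀ n, (E L).indicator (fun n : ℕ => Real.exp (-s L * n) / Z L) n =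
        (E L).indicator (fun n : ℕ => Real.exp (-s L * n)) n / Z L := fun n => by
      by_cases hn : n ∈ E L <;> simp [hn]
    simp_rw [h4]
    rw [integral_div, eq_sub_iff_add_eq, ← add_div, hT]
    simp only
    rw [h3]
    exact div_self (lt_of_lt_of_le one_half_pos h2).ne'
  have hT0 : ∀ L, 0 ≤ T L := fun L =>
    integral_nonneg fun n => Set.indicator_nonneg (fun n _ => (Real.exp_pos _).le) n
  refine tendsto_sqrt_mul_totalMass hm2 hm0 hm1 hN ?_ ?_ (fun n => ?_) ?_ ?_
  · filter_upwards [hs, hZh] with L h1 h2 n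
    have hZ0 : 0 < Z L := by linarith
    have h3 : Real.exp (-s L * n) / Z L ≤ 2 := by
      rw [div_le_iff₀ hZ0]
      linarith [exp_neg_mul_le_one h1 n]
    by_cases hn : n ∈ E L
    · rw [Set.indicator_of_mem hn]
      exact ⟨div_nonneg (Real.exp_pos _).le hZ0.le, h3⟩
    · rw [Set.indicator_of_notMem hn]
      exact ⟨le_rfl, zero_le_two⟩
  · filter_upwards [hcompl, hZh] with L h1 h2
    rw [h1]
    have := div_nonneg (hT0 L) (by linarith : 0 ≤ Z L)
    linarith
  · have h1 : Tendsto (fun L => Real.exp (-s L * n) / Z L) atTop (𝓝 1) := by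
      have h2 : Tendsto (fun L => Real.exp (-s L * n)) atTop (𝓝 1) := by
        have := (Real.continuous_exp.tendsto _).comp (hs0.neg.mul_const (n : ℝ))
        simpa [Function.comp_def] using this
      simpa [Pi.div_def] using h2.div hZ one_ne_zero
    refine h1.congr' ?_
    filter_upwards [hE n] with L hL
    rw [Set.indicator_of_mem hL]
  · have h1 := htail.div hZ one_ne_zero
    rw [div_one] at h1
    refine h1.congr' ?_
    filter_upwards [hcompl] with L h
    rw [h]
    simp only [Pi.div_apply, hT]
    ring
  -- Truncation at `r = L^{1/4}`. On the removed set, occupations below `r` contribute at most `√L ·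
  -- r · T = (L T)/r`, and those above satisfy `n ≤ n⁴/r³`, contributing at most `√L C/r³ = C/r`.
  · set r : ℕ → ℝ := fun L => √√(L : ℝ) with hr
    set a : ℕ → ℝ := fun L => (N L : ℝ) / L with ha
    set C := ∫ n : ℕ, (n : ℝ) ^ 4 ∂m with hC
    have hsq : Tendsto (fun L : ℕ => √(L : ℝ)) atTop atTop :=
      Real.tendsto_sqrt_atTop.comp tendsto_natCast_atTop_atTop
    have hrt : Tendsto r atTop atTop := Real.tendsto_sqrt_atTop.comp hsq
    have hbound : Tendsto (fun L : ℕ => ((r L)⁻¹ + |a L| * (√(L : ℝ))⁻¹) * (L * T L) / Z L +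
        C * (r L)⁻¹ / Z L) atTop (𝓝 0) := by
      have h1 := ((hrt.inv_tendsto_atTop.add (hN.abs.mul hsq.inv_tendsto_atTop)).mul htail).div hZ
        one_ne_zero
      have h2 := (hrt.inv_tendsto_atTop.const_mul C).div hZ one_ne_zero
      have h3 := h1.add h2
      simp only [mul_zero, add_zero, zero_mul, zero_div] at h3
      exact h3
    refine squeeze_zero_norm' ?_ hbound
    filter_upwards [hs, hZh, hmean, eventually_gt_atTop 0] with L h1 h2 h3 h4
    have hZ0 : 0 < Z L := by linarith
    have hL0 : (0 : ℝ) < L := by exact_mod_cast h4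
    have hsL : 0 < √(L : ℝ) := Real.sqrt_pos.2 hL0
    have hrL : 0 < r L := Real.sqrt_pos.2 hsL
    have hr2 : r L ^ 2 = √(L : ℝ) := Real.sq_sqrt hsL.le
    have hr4 : r L ^ 4 = L := by
      rw [show (4 : ℕ) = 2 * 2 by norm_num, pow_mul, hr2, Real.sq_sqrt hL0.le]
    have hn := integrable_natCast hm2
    set f : ℕ → ℝ := fun n => ((n : ℝ) - a L) * Real.exp (-s L * n) with hf
    have hfi : Integrable f m := integrable_mul_exp_neg_mul (hn.sub (integrable_const _)) h1
    have hsplit := integral_add_compl (MeasurableSet.of_discrete (s := E L)) hfi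
    -- The full tilted law is centred at `a L`, so the restricted first moment is minus the one over
    -- the complement.
    have e1 : ∫ n, (E L).indicator (fun n : ℕ => Real.exp (-s L * n) / Z L) n * ((n : ℝ) - a L) ∂m =
        -(∫ n in (E L)ᶜ, f n ∂m) / Z L := by
      have h5 : ∀ n : ℕ, (E L).indicator (fun n : ℕ => Real.exp (-s L * n) / Z L) n *
          ((n : ℝ) - a L) = (E L).indicator f n / Z L := fun n => by
        by_cases hn : n ∈ E L
        · simp only [hn, Set.indicator_of_mem, hf]; ring
        · simp [hn]
      simp_rw [h5]
      rw [integral_div, integral_indicator MeasurableSet.of_discrete]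
      congr 1
      linarith
    have e2 : |∫ n in (E L)ᶜ, f n ∂m| ≤ (r L + |a L|) * T L + C / r L ^ 3 := by
      rw [← integral_indicator MeasurableSet.of_discrete]
      have hTi : Integrable ((E L)ᶜ.indicator (fun n : ℕ => Real.exp (-s L * n))) m :=
        (integrable_exp_neg_mul h1).indicator MeasurableSet.of_discrete
      have h5 : (r L + |a L|) * T L + C / r L ^ 3 = ∫ n : ℕ, ((r L + |a L|) *
          (E L)ᶜ.indicator (fun n : ℕ => Real.exp (-s L * n)) n + (n : ℝ) ^ 4 / r L ^ 3) ∂m := by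
        rw [integral_add (hTi.const_mul _) (hm4.div_const _), integral_const_mul, integral_div]
      rw [h5]
      refine (abs_integral_le_integral_abs).trans (integral_mono ?_ ?_ fun n => ?_)
      · exact (hfi.indicator MeasurableSet.of_discrete).abs
      · exact (hTi.const_mul _).add (hm4.div_const _)
      · simp only
        by_cases hn : n ∈ (E L)ᶜ
        · rw [Set.indicator_of_mem hn, Set.indicator_of_mem hn, hf]
          simp only
          rw [abs_mul, abs_of_pos (Real.exp_pos _)]
          have hn0 : (0 : ℝ) ≤ n := Nat.cast_nonneg n
          have h6 : |(n : ℝ) - a L| ≤ n + |a L| := by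
            have := abs_sub (n : ℝ) (a L)
            rwa [abs_of_nonneg hn0] at this
          have h7 : (n : ℝ) * Real.exp (-s L * n) ≤
              r L * Real.exp (-s L * n) + (n : ℝ) ^ 4 / r L ^ 3 := by
            rcases le_total (n : ℝ) (r L) with h | h
            · have h8 := mul_le_mul_of_nonneg_right h (Real.exp_pos (-s L * n)).le
              have : 0 ≤ (n : ℝ) ^ 4 / r L ^ 3 := by positivity
              linarith
            · have h8 : (n : ℝ) ≤ (n : ℝ) ^ 4 / r L ^ 3 := by
                rw [le_div_iff₀ (by positivity), show (n : ℝ) ^ 4 = n * n ^ 3 by ring]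
                gcongr
              have h9 := mul_le_of_le_one_right hn0 (exp_neg_mul_le_one h1 n)
              have : 0 ≤ r L * Real.exp (-s L * n) := by positivity
              linarith
          nlinarith [mul_le_mul_of_nonneg_right h6 (Real.exp_pos (-s L * n)).le]
        · rw [Set.indicator_of_notMem hn, Set.indicator_of_notMem hn, abs_zero]
          positivity
    rw [e1, norm_mul, Real.norm_of_nonneg hsL.le, norm_div, norm_neg, Real.norm_eq_abs,
      Real.norm_of_nonneg hZ0.le]
    calc √(L : ℝ) * (|∫ n in (E L)ᶜ, f n ∂m| / Z L)
        ≤ √(L : ℝ) * (((r L + |a L|) * T L + C / r L ^ 3) / Z L) := by gcongr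
      _ = _ := by
          rw [← hr2, ← hr4]
          field_simp

/-- Conditional on `S_L = N`, all occupation numbers lie in `E_L` with limiting probability
`e^{-τ}`. -/
lemma tendsto_cond_forall_mem [IsProbabilityMeasure m] (hm4 : Integrable (fun n : ℕ => (n : ℝ) ^ 4) m)
    (hm2 : Integrable (fun n : ℕ => (n : ℝ) ^ 2) m)
    (hm0 : 0 < m.real {0}) (hm1 : 0 < m.real {1}) {N : ℕ → ℕ} {ρ τ : ℝ} {s : ℕ → ℝ}
    {E : ℕ → Set ℕ}
    (hN : Tendsto (fun L : ℕ => (N L : ℝ) / L) atTop (𝓝 ρ)) (hs : ∀ᶠ L in atTop, 0 ≤ s L)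
    (hs0 : Tendsto s atTop (𝓝 0))
    (hmean : ∀ᶠ L : ℕ in atTop, ∫ n, ((n : ℝ) - N L / L) * Real.exp (-s L * n) ∂m = 0)
    (hE : ∀ n, ∀ᶠ L in atTop, n ∈ E L)
    (htail : Tendsto (fun L : ℕ => (L : ℝ) * ∫ n, (E L)ᶜ.indicator
      (fun n : ℕ => Real.exp (-s L * n)) n ∂m) atTop (𝓝 τ)) :
    Tendsto (fun L : ℕ => (ProbabilityTheory.cond (Measure.pi fun _ : Fin L => m)
      {η | total η = N L}).real {η | ∀ i, η i ∈ E L}) atTop (𝓝 (Real.exp (-τ))) := by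
  have h1 := tendsto_sqrt_mul_totalMass_tilt hm4 hm2 hm0 hm1 hN hs hs0 hmean hE htail
  -- The unrestricted case, with `τ = 0`, gives the normalisation; the constant and the tilting
  -- factor cancel in the quotient.
  have h2 := tendsto_sqrt_mul_totalMass_tilt (τ := 0) (E := fun _ => Set.univ) hm4 hm2 hm0 hm1 hN hs
    hs0 hmean (fun n => Eventually.of_forall fun _ => Set.mem_univ n) (by simp)
  have hK := localLimitConst_pos hm2 hm0 hm1 ρ
  have h3 := h1.div h2 (by rw [neg_zero, Real.exp_zero, mul_one]; exact hK.ne')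
  rw [neg_zero, Real.exp_zero, mul_one, mul_div_cancel_left₀ _ hK.ne'] at h3
  refine h3.congr' ?_
  filter_upwards [hs, eventually_gt_atTop 0] with L h4 h5
  have hs : √(L : ℝ) ≠ 0 := (Real.sqrt_pos.2 (by exact_mod_cast h5)).ne'
  have hc : Real.exp (-s L * N L) / tiltNorm m (s L) ^ L ≠ 0 :=
    div_ne_zero (Real.exp_pos _).ne' (pow_ne_zero _ (tiltNorm_pos h4).ne')
  have hcond : (ProbabilityTheory.cond (Measure.pi fun _ : Fin L => m)
      {η | total η = N L}).real {η | ∀ i, η i ∈ E L} =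
      ((Measure.pi fun _ : Fin L => m).real {η | total η = N L})⁻¹ *
        (Measure.pi fun _ : Fin L => m).real ({η | total η = N L} ∩ {η | ∀ i, η i ∈ E L}) := by
    rw [measureReal_def, ProbabilityTheory.cond_apply (Set.to_countable _).measurableSet,
      ENNReal.toReal_mul, ENNReal.toReal_inv]
    rfl
  simp only [Pi.div_apply]
  rw [totalMass_tilt, totalMass_tilt, totalMass_indicator_one, totalMass_indicator_one,
    mul_div_mul_left _ _ hs, mul_div_mul_left _ _ hc, hcond]
  simp [div_eq_inv_mul]

end Fugacity

/-! ### Gumbel limits, free and conditioned. -/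

section Limits

variable {g : ℕ → ℝ} {lam b A : ℝ}

lemma siteMeasure_real_tail (hg : IsStretchedExp g lam b A) {u : ℝ} (hu : 0 ≤ u) :
    (siteMeasure g 1).real {n : ℕ | (n : ℝ) ≤ u}ᶜ =
      tailSum (weight g) 0 ⌊u⌋₊ / partitionFn g 1 := by
  rw [← integral_tail_siteMeasure hg le_rfl hu]
  simp only [neg_zero, zero_mul, Real.exp_zero]
  rw [integral_indicator_const _ MeasurableSet.of_discrete, smul_eq_mul, mul_one]

lemma grandCanonical_real_maxOcc_le (hg : IsStretchedExp g lam b A) {L : ℕ} (hL : 0 < L) {u : ℝ}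
    (hu : 0 ≤ u) : (grandCanonical g 1 L).real {η | (maxOcc η : ℝ) ≤ u} =
      (1 - tailSum (weight g) 0 ⌊u⌋₊ / partitionFn g 1) ^ L := by
  have := isProbabilityMeasure_siteMeasure hg
  rw [setOf_maxOcc_le hL, grandCanonical, pi_real_setOf_forall_mem, siteMeasure_real_tail hg hu]

/-- Recovers tail asymptotics from an extreme value limit, as needed for critical scales that are
given and not constructed. With `ℓ = -log(1-T)`, the limit gives `L ℓ → τ`, and `(1-T) ℓ ≤ T ≤ ℓ`.
-/
lemma tendsto_mul_of_tendsto_one_sub_pow {T : ℕ → ℝ} {τ : ℝ}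
    (hT1 : ∀ᶠ L in atTop, T L ≤ 1)
    (h : Tendsto (fun L : ℕ => (1 - T L) ^ L) atTop (𝓝 (Real.exp (-τ)))) :
    Tendsto (fun L : ℕ => (L : ℝ) * T L) atTop (𝓝 τ) := by
  have hpos : ∀ᶠ L : ℕ in atTop, 0 < 1 - T L := by
    filter_upwards [hT1, h.eventually_const_lt (Real.exp_pos _), eventually_gt_atTop 0]
      with L h1 h2 h3
    refine lt_of_le_of_ne (by linarith) fun h4 => ?_
    rw [← h4, zero_pow h3.ne'] at h2
    exact lt_irrefl _ h2
  have hlog : Tendsto (fun L : ℕ => (L : ℝ) * -Real.log (1 - T L)) atTop (𝓝 τ) := by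
    have := (h.log (Real.exp_pos _).ne').neg
    rw [Real.log_exp, neg_neg] at this
    refine this.congr fun L => ?_
    rw [Real.log_pow]; ring
  have hlog0 : Tendsto (fun L : ℕ => Real.log (1 - T L)) atTop (𝓝 0) := by
    have := (hlog.mul tendsto_inv_atTop_nhds_zero_nat).neg
    rw [mul_zero, neg_zero] at this
    refine this.congr' ?_
    filter_upwards [eventually_gt_atTop 0] with L hL
    have : (L : ℝ) ≠ 0 := by exact_mod_cast hL.ne'
    field_simp
  have hone : Tendsto (fun L : ℕ => 1 - T L) atTop (𝓝 1) := by
    have := (Real.continuous_exp.tendsto _).comp hlog0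
    rw [Real.exp_zero] at this
    refine this.congr' ?_
    filter_upwards [hpos] with L hL using Real.exp_log hL
  have hlow := hone.mul hlog
  rw [one_mul] at hlow
  refine tendsto_of_tendsto_of_tendsto_of_le_of_le' hlow hlog ?_ ?_
  · filter_upwards [hpos] with L hL
    have h1 := Real.one_sub_inv_le_log_of_pos hL
    have h2 : (1 - T L) * (1 - (1 - T L)⁻¹) = -T L := by
      rw [mul_sub, mul_inv_cancel₀ hL.ne']; ring
    have h3 := mul_le_mul_of_nonneg_left h1 hL.le
    rw [h2] at h3
    calc (1 - T L) * (L * -Real.log (1 - T L)) = L * -((1 - T L) * Real.log (1 - T L)) := by ring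
      _ ≤ L * T L := by gcongr; linarith
  · filter_upwards [hpos] with L hL
    have := Real.log_le_sub_one_of_pos hL
    gcongr
    linarith

/-- For i.i.d. occupation numbers, extreme value limits are equivalent to limits of tails. -/
lemma tendsto_grandCanonical_maxOcc_iff (hg : IsStretchedExp g lam b A) {u : ℕ → ℝ}
    (hu : ∀ᶠ L in atTop, 0 ≤ u L) (τ : ℝ) :
    Tendsto (fun L : ℕ => (grandCanonical g 1 L).real {η | (maxOcc η : ℝ) ≤ u L}) atTop
        (𝓝 (Real.exp (-τ))) ↔
      Tendsto (fun L : ℕ => (L : ℝ) * (tailSum (weight g) 0 ⌊u L⌋₊ / partitionFn g 1)) atTop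
        (𝓝 τ) := by
  have := isProbabilityMeasure_siteMeasure hg
  have heq : (fun L : ℕ => (grandCanonical g 1 L).real {η | (maxOcc η : ℝ) ≤ u L}) =ᶠ[atTop]
      fun L => (1 - tailSum (weight g) 0 ⌊u L⌋₊ / partitionFn g 1) ^ L := by
    filter_upwards [hu, eventually_gt_atTop 0] with L h1 h2
      using grandCanonical_real_maxOcc_le hg h2 h1
  rw [tendsto_congr' heq]
  constructor
  · refine tendsto_mul_of_tendsto_one_sub_pow ?_
    filter_upwards [hu] with L h1
    rw [← siteMeasure_real_tail hg h1]
    exact measureReal_le_one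
  · intro h
    have h1 : Tendsto (fun L : ℕ => (L : ℝ) *
        -(tailSum (weight g) 0 ⌊u L⌋₊ / partitionFn g 1)) atTop (𝓝 (-τ)) :=
      h.neg.congr fun L => by ring
    exact (Real.tendsto_one_add_pow_exp_of_tendsto h1).congr fun L => by rw [← sub_eq_add_neg]

/-- Extreme value limits of the canonical measures from limits of tilted tails. -/
lemma tendsto_canonical_maxOcc (hg : IsStretchedExp g lam b A) {N : ℕ → ℕ} {s u : ℕ → ℝ} {τ : ℝ}
    (hN : Tendsto (fun L : ℕ => (N L : ℝ) / L) atTop (𝓝 (criticalDensity g)))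
    (hs : ∀ᶠ L in atTop, 0 ≤ s L) (hs0 : Tendsto s atTop (𝓝 0))
    (hmean : ∀ᶠ L : ℕ in atTop,
      ∫ n, ((n : ℝ) - N L / L) * Real.exp (-s L * n) ∂siteMeasure g 1 = 0)
    (hu : Tendsto u atTop atTop)
    (htail : Tendsto (fun L : ℕ => (L : ℝ) * (tailSum (weight g) (s L) ⌊u L⌋₊ / partitionFn g 1))
      atTop (𝓝 τ)) :
    Tendsto (fun L : ℕ => (canonical g L (N L)).real {η | (maxOcc η : ℝ) ≤ u L}) atTop
      (𝓝 (Real.exp (-τ))) := by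
  have := isProbabilityMeasure_siteMeasure hg
  have hm : ∀ k, 0 < (siteMeasure g 1).real {k} := fun k => by
    rw [siteMeasure_real_singleton hg]
    exact div_pos (weight_pos hg k) (partitionFn_pos hg)
  have h := tendsto_cond_forall_mem (E := fun L => {n : ℕ | (n : ℝ) ≤ u L})
    (integrable_pow_siteMeasure hg 4) (integrable_pow_siteMeasure hg 2) (hm 0) (hm 1) hN hs hs0 hmean
    (fun n => hu.eventually_ge_atTop (n : ℝ)) (htail.congr' ?_)
  · refine h.congr' ?_
    filter_upwards [eventually_gt_atTop 0] with L hL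
    rw [canonical, grandCanonical, setOf_maxOcc_le hL]
    rfl
  · filter_upwards [hs, hu.eventually_ge_atTop 0] with L h1 h2
    rw [integral_tail_siteMeasure hg h1 h2]

/-- `ω_L (log L)^{-1/(1-λ)}` is the density deficit `ρ_c - N/L`. The power of the logarithm is that
of the critical scale, so `ω_L` measures `s_L y_L` up to a constant. -/
lemma exists_tilt_of_isDownside (hg : IsStretchedExp g lam b A) {N : ℕ → ℕ} {ω : ℕ → ℝ}
    (hN : IsDownside g lam N ω) :
    ∃ σ2 > 0, ∃ s k : ℕ → ℝ, (∀ᶠ L in atTop, 0 ≤ s L) ∧ Tendsto s atTop (𝓝 0) ∧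
      Tendsto k atTop (𝓝 σ2) ∧
      (∀ᶠ L : ℕ in atTop, s L * k L = ω L * Real.log (L : ℝ) ^ (-(1 / (1 - lam)))) ∧
      ∀ᶠ L : ℕ in atTop,
        ∫ n, ((n : ℝ) - N L / L) * Real.exp (-s L * n) ∂siteMeasure g 1 = 0 := by
  have := isProbabilityMeasure_siteMeasure hg
  have hm : ∀ k, 0 < (siteMeasure g 1).real {k} := fun k => by
    rw [siteMeasure_real_singleton hg]
    exact div_pos (weight_pos hg k) (partitionFn_pos hg)
  have hm2 := integrable_pow_siteMeasure hg 2
  have hdef : ∀ᶠ L : ℕ in atTop, criticalDensity g - N L / L =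
      ω L * Real.log (L : ℝ) ^ (-(1 / (1 - lam))) := by
    filter_upwards [hN.eq, eventually_gt_atTop 0] with L h1 h2
    have : (L : ℝ) ≠ 0 := by exact_mod_cast h2.ne'
    rw [h1]
    field_simp
    ring
  obtain ⟨s, k, h1, h2, h3, h4, h5⟩ := exists_tilt hm2 (hm 0) (hm 1)
    (ρ := criticalDensity g) rfl hN.critical (by
      filter_upwards [hdef, hN.nonneg, eventually_ge_atTop 1] with L h1 h2 h3
      have h4 : 0 ≤ Real.log (L : ℝ) := Real.log_nonneg (by exact_mod_cast h3)
      have h5 : 0 ≤ ω L * Real.log (L : ℝ) ^ (-(1 / (1 - lam))) := by positivity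
      linarith)
  refine ⟨_, integral_sub_sq_pos hm2 (hm 0) (hm 1) (criticalDensity g), s, k, h1, h2, h3, ?_, h5⟩
  filter_upwards [h4, hdef] with L h6 h7
  rw [h6, h7]

lemma tendsto_log_natCast : Tendsto (fun L : ℕ => Real.log (L : ℝ)) atTop atTop :=
  Real.tendsto_log_atTop.comp tendsto_natCast_atTop_atTop

lemma tendsto_atTop_of_scale (hl : lam < 1) (hb : 0 < b) {y : ℕ → ℝ}
    (hy : y ~[atTop] fun L : ℕ => ((1 - lam) / b * Real.log (L : ℝ)) ^ (1 / (1 - lam))) :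
    Tendsto y atTop atTop := by
  have h1 : 0 < 1 - lam := by linarith
  exact hy.symm.tendsto_atTop ((tendsto_rpow_atTop (by positivity)).comp
    (tendsto_log_natCast.const_mul_atTop (by positivity)))

/-- The width `y^λ/b` is `o(y)`, so a tilt acts by the same limiting factor across the Gumbel
window. -/
lemma tendsto_add_mul_div_self (hl : lam < 1) {y ζ : ℕ → ℝ}
    (hy : Tendsto y atTop atTop) (hζ : ζ ~[atTop] fun L => y L ^ lam / b) (x : ℝ) :
    Tendsto (fun L => (y L + x * ζ L) / y L) atTop (𝓝 1) := by
  have h1 : Tendsto (fun L => ζ L / y L) atTop (𝓝 0) := by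
    have h2 : (fun L => y L ^ lam / b) =o[atTop] y := by
      have h3 : Tendsto (fun L => y L ^ (lam - 1) / b) atTop (𝓝 0) := by
        have := ((tendsto_rpow_neg_atTop (by linarith : 0 < 1 - lam)).comp hy).div_const b
        simpa [Function.comp_def] using this
      refine (isLittleO_iff_tendsto' ?_).2 (h3.congr' ?_)
      · filter_upwards [hy.eventually_gt_atTop 0] with L h h0 using absurd h0 h.ne'
      · filter_upwards [hy.eventually_gt_atTop 0] with L h
        rw [Real.rpow_sub_one h.ne']
        field_simp
    exact (hζ.isBigO.trans_isLittleO h2).tendsto_div_nhds_zero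
  have h2 := (h1.const_mul x).const_add 1
  rw [mul_zero, add_zero] at h2
  refine h2.congr' ?_
  filter_upwards [hy.eventually_gt_atTop 0] with L h
  field_simp

lemma tendsto_add_mul_atTop (hl : lam < 1) {y ζ : ℕ → ℝ}
    (hy : Tendsto y atTop atTop) (hζ : ζ ~[atTop] fun L => y L ^ lam / b) (x : ℝ) :
    Tendsto (fun L => y L + x * ζ L) atTop atTop := by
  refine (hy.atTop_mul_pos one_pos (tendsto_add_mul_div_self hl hy hζ x)).congr' ?_
  filter_upwards [hy.eventually_gt_atTop 0] with L h
  field_simp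

/-- For `ω_L → c < ∞` the canonical limit differs from the critical one by a constant shift. -/
lemma exists_canonical_shift (hg : IsStretchedExp g lam b A) {N : ℕ → ℕ} {ω : ℕ → ℝ} {c : ℝ}
    (hN : IsDownside g lam N ω) (hω : Tendsto ω atTop (𝓝 c)) :
    ∃ κ : ℝ, (c = 0 → κ = 0) ∧ ∀ y ζ : ℕ → ℝ,
      y ~[atTop] (fun L : ℕ => ((1 - lam) / b * Real.log (L : ℝ)) ^ (1 / (1 - lam))) →
      ζ ~[atTop] (fun L => y L ^ lam / b) → ∀ x τ : ℝ,
      Tendsto (fun L : ℕ => (L : ℝ) *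
        (tailSum (weight g) 0 ⌊y L + x * ζ L⌋₊ / partitionFn g 1)) atTop (𝓝 τ) →
      Tendsto (fun L : ℕ => (canonical g L (N L)).real {η | (maxOcc η : ℝ) ≤ y L + x * ζ L}) atTop
        (𝓝 (Real.exp (-(τ * Real.exp (-κ))))) := by
  have hl0 := hg.lam_pos
  have hl := hg.lam_lt_one
  have hb := hg.b_pos
  have h1l : 0 < 1 - lam := by linarith
  obtain ⟨σ2, hσ, s, k, hs, hs0, hk, hsk, hmean⟩ := exists_tilt_of_isDownside hg hN
  set p := 1 / (1 - lam) with hp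
  -- This `κ` is the limit of `s_L y_L`: the factor `c / σ2` comes from `s_L (log L)^p`, the other
  -- from `y_L / (log L)^p`.
  refine ⟨c / σ2 * ((1 - lam) / b) ^ p, fun h => by rw [h]; simp, fun y ζ hy hζ x τ hτ => ?_⟩
  have hytop := tendsto_atTop_of_scale hl hb hy
  have hu := tendsto_add_mul_atTop hl hytop hζ x
  have hslog : Tendsto (fun L : ℕ => s L * Real.log (L : ℝ) ^ p) atTop (𝓝 (c / σ2)) := by
    refine (hω.div hk hσ.ne').congr' ?_
    filter_upwards [hsk, tendsto_log_natCast.eventually_gt_atTop 0, hk.eventually_const_lt hσ]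
      with L h1 h2 h3
    have h4 : 0 < Real.log (L : ℝ) ^ p := Real.rpow_pos_of_pos h2 _
    rw [Real.rpow_neg h2.le] at h1
    simp only [Pi.div_apply]
    rw [div_eq_iff h3.ne']
    calc ω L = ω L * (Real.log (L : ℝ) ^ p)⁻¹ * Real.log (L : ℝ) ^ p := by field_simp
      _ = _ := by rw [← h1]; ring
  have hratio : Tendsto (fun L : ℕ => y L / ((1 - lam) / b * Real.log (L : ℝ)) ^ p) atTop (𝓝 1) := by
    refine (isEquivalent_iff_tendsto_one ?_).1 hy
    filter_upwards [tendsto_log_natCast.eventually_gt_atTop 0] with L h2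
    positivity
  have hsu : Tendsto (fun L => s L * (y L + x * ζ L)) atTop
      (𝓝 (c / σ2 * ((1 - lam) / b) ^ p)) := by
    have h1 := ((hslog.mul_const (((1 - lam) / b) ^ p)).mul hratio).mul
      (tendsto_add_mul_div_self hl hytop hζ x)
    rw [mul_one, mul_one] at h1
    refine h1.congr' ?_
    filter_upwards [tendsto_log_natCast.eventually_gt_atTop 0, hytop.eventually_gt_atTop 0]
      with L h2 h3
    rw [Real.mul_rpow (by positivity) h2.le]
    have h4 : 0 < Real.log (L : ℝ) ^ p := Real.rpow_pos_of_pos h2 _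
    have h5 : 0 < ((1 - lam) / b) ^ p := Real.rpow_pos_of_pos (by positivity) _
    field_simp
  refine tendsto_canonical_maxOcc hg hN.critical hs hs0 hmean hu ?_
  have h1 := hτ.mul (tendsto_tailSum_tilt hl0 hl hb hg.A_pos hg.weight_equiv hs hs0 hu hsu)
  refine h1.congr' ?_
  have hne := tendsto_tailSum_floor_div (s := fun _ => 0) hl0 hl hb hg.A_pos hg.weight_equiv
    (Eventually.of_forall fun _ => le_rfl) tendsto_const_nhds hu
  filter_upwards [hne.eventually_const_lt hg.A_pos] with L h2
  have h3 : tailSum (weight g) 0 ⌊y L + x * ζ L⌋₊ ≠ 0 := fun h => by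
    rw [h, zero_div] at h2; exact lt_irrefl _ h2
  field_simp

lemma tiltSlope_zero_inv {t : ℝ} (ht : 0 ≤ t) : (tiltSlope lam b 0 t)⁻¹ = t ^ lam / b := by
  rw [tiltSlope, add_zero, Real.rpow_neg ht, mul_inv, inv_inv, div_eq_inv_mul]

/-- Strictly increasing scales at which the critical tails converge. -/
lemma exists_strictMono_critical_scale (hg : IsStretchedExp g lam b A) (κ : ℝ) :
    ∃ y ζ : ℕ → ℝ, StrictMono y ∧ StrictMono ζ ∧ Tendsto y atTop atTop ∧ Tendsto ζ atTop atTop ∧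
      y ~[atTop] (fun L : ℕ => ((1 - lam) / b * Real.log (L : ℝ)) ^ (1 / (1 - lam))) ∧
      ζ ~[atTop] (fun L => y L ^ lam / b) ∧
      ∀ x : ℝ, Tendsto (fun L : ℕ => (L : ℝ) *
        (tailSum (weight g) 0 ⌊y L + x * ζ L⌋₊ / partitionFn g 1)) atTop
        (𝓝 (Real.exp κ * Real.exp (-x))) := by
  have hl0 := hg.lam_pos
  have hl := hg.lam_lt_one
  have hb := hg.b_pos
  have hA := hg.A_pos
  have hz := partitionFn_pos hg
  obtain ⟨v₀, hv₀, H⟩ := exists_strictMono_scale hl0 hl hb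
  -- At profile level `B/L` the normalised tail is asymptotically `e^κ / L`.
  set B := partitionFn g 1 / A * Real.exp κ with hB
  have hB0 : 0 < B := by positivity
  -- Replacing `L` by `L + K + 1` puts every level, from `L = 0` on, below `v₀`, so monotonicity
  -- holds on all of `ℕ`; the limits are unaffected.
  obtain ⟨K, hK⟩ := exists_nat_gt (B / v₀)
  have hden : ∀ L : ℕ, (0 : ℝ) < L + K + 1 := fun L => by positivity
  set v : ℕ → ℝ := fun L => B / (L + K + 1) with hv
  have hvlim : Tendsto v atTop (𝓝 0) := by
    have h1 : Tendsto (fun L : ℕ => (L : ℝ) + K + 1) atTop atTop :=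
      tendsto_atTop_add_const_right _ _
        (tendsto_atTop_add_const_right _ _ tendsto_natCast_atTop_atTop)
    exact h1.const_div_atTop B
  obtain ⟨y, hymono, hy1, hytop, hyv⟩ := H v (fun L => div_pos hB0 (hden L)) (fun L => by
      rw [hv]
      simp only
      rw [div_lt_iff₀ hv₀] at hK
      rw [div_le_iff₀ (hden L)]
      have : (0 : ℝ) ≤ L := Nat.cast_nonneg L
      nlinarith [mul_nonneg hv₀.le this])
    (fun i j hij => by
      have : (i : ℝ) < j := by exact_mod_cast hij
      exact div_lt_div_of_pos_left hB0 (hden i) (by linarith)) hvlim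
  have hy0 : ∀ L, 0 < y L := fun L => one_pos.trans_le (hy1 L)
  have hζ : (fun L => (tiltSlope lam b 0 (y L))⁻¹) = fun L => y L ^ lam / b :=
    funext fun L => tiltSlope_zero_inv (hy0 L).le
  have hquot : Tendsto (fun L : ℕ => (L : ℝ) / (L + K + 1)) atTop (𝓝 1) := by
    have h1 := tendsto_natCast_div_add_atTop ((K : ℝ) + 1)
    exact h1.congr fun L => by rw [add_assoc]
  refine ⟨y, fun L => y L ^ lam / b, hymono, fun i j hij => ?_, hytop, ?_, ?_, IsEquivalent.refl,
    fun x => ?_⟩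
  · exact div_lt_div_of_pos_right (Real.rpow_lt_rpow (hy0 i).le (hymono hij) hl0) hb
  · exact ((tendsto_rpow_atTop hl0).comp hytop).atTop_div_const hb
  · refine scale_isEquivalent (a := fun L => -Real.log (v L)) (a' := fun L : ℕ => Real.log (L : ℝ))
      hl hb hytop (Eventually.of_forall fun L => ?_) ?_ tendsto_log_natCast
    · rw [hyv, neg_neg, Real.exp_log (div_pos hB0 (hden L))]
    · have h1 : Tendsto (fun L : ℕ => -Real.log ((L : ℝ) / (L + K + 1)) - Real.log B) atTop
          (𝓝 (-Real.log 1 - Real.log B)) := ((hquot.log one_ne_zero).neg).sub_const _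
      have h2 : (fun L : ℕ => -Real.log ((L : ℝ) / (L + K + 1)) - Real.log B) =o[atTop]
          fun L : ℕ => Real.log (L : ℝ) :=
        (h1.isBigO_one ℝ).trans_isLittleO (isLittleO_const_left.2
          (Or.inr (tendsto_norm_atTop_atTop.comp tendsto_log_natCast)))
      refine h2.congr' ?_ EventuallyEq.rfl
      filter_upwards [eventually_gt_atTop 0] with L hL
      have hL0 : (L : ℝ) ≠ 0 := by exact_mod_cast hL.ne'
      simp only [Pi.sub_apply, hv]
      rw [Real.log_div hL0 (hden L).ne', Real.log_div hB0.ne' (hden L).ne']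
      ring
  · have h1 := tendsto_tailSum_scale (s := fun _ => 0) hl0 hl hb hA hg.weight_equiv
      (Eventually.of_forall fun _ => le_rfl) tendsto_const_nhds hytop
      (Eventually.of_forall hyv) x
    have h2 := (h1.mul hquot).mul_const (Real.exp κ / A)
    have h3 : A * Real.exp (-x) * 1 * (Real.exp κ / A) = Real.exp κ * Real.exp (-x) := by
      field_simp
    rw [h3] at h2
    refine h2.congr fun L => ?_
    have h4 : y L ^ lam / b = (tiltSlope lam b 0 (y L))⁻¹ := (congrFun hζ L).symm
    beta_reduce
    rw [h4]
    have h5 := hden L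
    have h6 := Real.exp_pos κ
    simp only [hv, hB]
    field_simp

lemma exists_critical_gumbel_scale (hg : IsStretchedExp g lam b A) :
    ∃ y bL : ℕ → ℝ, IsCriticalGumbelScale g lam b y bL := by
  obtain ⟨y, ζ, -, -, hytop, -, hy, hζ, h⟩ := exists_strictMono_critical_scale hg 0
  refine ⟨y, ζ, hy, hζ, fun x => ?_⟩
  have hu := tendsto_add_mul_atTop hg.lam_lt_one hytop hζ x
  rw [tendsto_grandCanonical_maxOcc_iff hg (hu.eventually_ge_atTop 0)]
  simpa using h x

lemma canonical_gumbel_of_tendsto_zero (hg : IsStretchedExp g lam b A) {y bL : ℕ → ℝ}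
    (hy : IsCriticalGumbelScale g lam b y bL) {N : ℕ → ℕ} {ω : ℕ → ℝ}
    (hN : IsDownside g lam N ω) (hω : Tendsto ω atTop (𝓝 0)) :
    MaxGumbelLimit (fun L => canonical g L (N L)) y bL := by
  intro x
  obtain ⟨κ, hκ, h⟩ := exists_canonical_shift hg hN hω
  have hytop := tendsto_atTop_of_scale hg.lam_lt_one hg.b_pos hy.y_equiv
  have hu := tendsto_add_mul_atTop hg.lam_lt_one hytop hy.b_equiv x
  have h1 := h y bL hy.y_equiv hy.b_equiv x _
    ((tendsto_grandCanonical_maxOcc_iff hg (hu.eventually_ge_atTop 0) _).1 (hy.gumbel x))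
  rwa [hκ rfl, neg_zero, Real.exp_zero, mul_one] at h1

/-- The critical scale is built with the factor `e^κ` in the tail, which cancels the `e^{-κ}` caused
by the tilt. -/
lemma exists_canonical_scale_of_tendsto (hg : IsStretchedExp g lam b A) {N : ℕ → ℕ} {ω : ℕ → ℝ}
    {c : ℝ} (hN : IsDownside g lam N ω) (hω : Tendsto ω atTop (𝓝 c)) :
    ∃ γ ζ : ℕ → ℝ, Tendsto γ atTop atTop ∧ Tendsto ζ atTop atTop ∧ StrictMono γ ∧ StrictMono ζ ∧
      MaxGumbelLimit (fun L => canonical g L (N L)) γ ζ := by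
  obtain ⟨κ, -, h⟩ := exists_canonical_shift hg hN hω
  obtain ⟨y, ζ, hym, hζm, hytop, hζtop, hy, hζ, ht⟩ := exists_strictMono_critical_scale hg κ
  refine ⟨y, ζ, hytop, hζtop, hym, hζm, fun x => ?_⟩
  have h1 := h y ζ hy hζ x _ (ht x)
  have h2 : Real.exp κ * Real.exp (-x) * Real.exp (-κ) = Real.exp (-x) := by
    rw [← Real.exp_add, ← Real.exp_add]; congr 1; ring
  rwa [h2] at h1

/-- With no limit of `s_L y_L` available, the scale is read off the profile tilted by `s_L` itself,
at level `z(1)/(A L)`. As the tilt varies with `L`, this construction does not provide monotonicity.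
-/
lemma exists_canonical_scale (hg : IsStretchedExp g lam b A) {N : ℕ → ℕ} {ω : ℕ → ℝ}
    (hN : IsDownside g lam N ω) :
    ∃ γ ζ : ℕ → ℝ, Tendsto γ atTop atTop ∧ Tendsto ζ atTop atTop ∧
      MaxGumbelLimit (fun L => canonical g L (N L)) γ ζ := by
  have hl0 := hg.lam_pos
  have hl := hg.lam_lt_one
  have hb := hg.b_pos
  have hA := hg.A_pos
  have hz := partitionFn_pos hg
  obtain ⟨-, -, s, -, hs, hs0, -, -, hmean⟩ := exists_tilt_of_isDownside hg hN
  set v : ℕ → ℝ := fun L => partitionFn g 1 / A / L with hv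
  obtain ⟨γ, hγ, hγv⟩ := exists_scale (v := v) hl0 hl hb hs hs0
    (by filter_upwards [eventually_gt_atTop 0] with L hL; positivity)
    (tendsto_const_div_atTop_nhds_zero_nat _)
  refine ⟨γ, fun L => (tiltSlope lam b (s L) (γ L))⁻¹, hγ, ?_, fun x => ?_⟩
  · refine (tendsto_nhdsWithin_iff.2 ⟨tendsto_tiltSlope hl0 hs0 hγ, ?_⟩).inv_tendsto_nhdsGT_zero
    filter_upwards [hs, hγ.eventually_gt_atTop 0] with L h1 h2 using tiltSlope_pos hb h1 h2
  · refine tendsto_canonical_maxOcc hg hN.critical hs hs0 hmean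
      (tendsto_scale_shift_atTop hl hb hs hγ x) ?_
    have h1 := (tendsto_tailSum_scale hl0 hl hb hA hg.weight_equiv hs hs0 hγ hγv x).div_const A
    rw [mul_div_cancel_left₀ _ hA.ne'] at h1
    refine h1.congr' ?_
    filter_upwards [eventually_gt_atTop 0] with L hL
    have : (L : ℝ) ≠ 0 := by exact_mod_cast hL.ne'
    simp only [hv]
    field_simp

end Limits
end ZeroRange

theorem theorem4 (g : ℕ → ℝ) (lam b A : ℝ) (hg : ZeroRange.IsStretchedExp g lam b A) :
    (∀ (N : ℕ → ℕ) (ω : ℕ → ℝ) (c : ℝ≥0∞), ZeroRange.IsDownside g lam N ω →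
      Tendsto (fun L => ENNReal.ofReal (ω L)) atTop (𝓝 c) →
      ∃ γ ζ : ℕ → ℝ, Tendsto γ atTop atTop ∧ Tendsto ζ atTop atTop ∧
        (c ≠ ∞ → StrictMono γ ∧ StrictMono ζ) ∧
        ZeroRange.MaxGumbelLimit (fun L => ZeroRange.canonical g L (N L)) γ ζ) ∧
    (∃ y bL : ℕ → ℝ, ZeroRange.IsCriticalGumbelScale g lam b y bL) ∧
    (∀ y bL : ℕ → ℝ, ZeroRange.IsCriticalGumbelScale g lam b y bL →
      ∀ (N : ℕ → ℕ) (ω : ℕ → ℝ), ZeroRange.IsDownside g lam N ω → Tendsto ω atTop (𝓝 0) →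
        ZeroRange.MaxGumbelLimit (fun L => ZeroRange.canonical g L (N L)) y bL) := by
  refine ⟨fun N ω c hN hω => ?_, ZeroRange.exists_critical_gumbel_scale hg,
    fun y bL hy N ω hN hω => ZeroRange.canonical_gumbel_of_tendsto_zero hg hy hN hω⟩
  -- For `c = ∞` no monotonicity is required and the tilted scale suffices; otherwise `ω` converges
  -- in `ℝ`, being eventually nonnegative.
  by_cases hc : c = ∞
  · obtain ⟨γ, ζ, h1, h2, h3⟩ := ZeroRange.exists_canonical_scale hg hN
    exact ⟨γ, ζ, h1, h2, fun h => absurd hc h, h3⟩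
  · have hω' : Tendsto ω atTop (𝓝 c.toReal) := by
      refine ((ENNReal.tendsto_toReal hc).comp hω).congr' ?_
      filter_upwards [hN.nonneg] with L hL using ENNReal.toReal_ofReal hL
    obtain ⟨γ, ζ, h1, h2, h3, h4, h5⟩ := ZeroRange.exists_canonical_scale_of_tendsto hg hN hω'
    exact ⟨γ, ζ, h1, h2, fun _ => ⟨h3, h4⟩, h5⟩
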